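/- Let $\Gamma\subset O(4)$ be a finite group and let $f:\mathbb{R}^4\to\mathbb{R}^4$ be a $C^1$, $\Gamma$-equivariant vector field. A (robust) heteroclinic cycle $X$ of $\dot y=f(y)$ consists of distinct equilibria $\xi_1,\dots,\xi_m$ (with $\xi_{m+1}=\xi_1$), not all in one $\Gamma$-orbit, together with connecting trajectories $[\xi_j\to\xi_{j+1}]\subset W^u(\xi_j)\cap W^s(\xi_{j+1})$ such that, for each $j$, there is an isotropy subgroup $\Sigma_j\subset\Gamma$ for which $[\xi_j\to\xi_{j+1}]\subset P_j=\mathrm{Fix}(\Sigma_j)$ and, for the flow restricted to $P_j$, $\xi_j$ is a saddle and $\xi_{j+1}$ is a sink. Put $L_j=P_{j-1}\cap P_j$. The cycle is simple if $X\subset\mathbb{R}^4\setminus\{0\}$, $\dim P_j=2$ for all $j$, the group orbit $\Gamma X$ meets each connected component of $L_j\setminus\{0\}$ in at most one point, and no $\mathrm{d}f(\xi_j)$ has a multiple eigenvalue. A simple cycle is of type $A$ if $\Sigma_j\cong\mathbb{Z}_2$ for all $j$; of type $B$ if $X\subset Q$ for some three-dimensional fixed-point subspace $Q=\mathrm{Fix}(K)$,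 $K\le\Gamma$; and of type $C$ if it is neither of type $A$ nor of type $B$. The number of equilibria of $X$ is the number of distinct $\Gamma$-orbits of its nodes; it is written as a subscript of the type, and the superscript $-$ means that $-\mathrm{Id}\in\Gamma$. A simple heteroclinic network is a connected union of finitely many simple cycles (all for the same $f$ and $\Gamma$) whose $\Gamma$-orbit meets each connected component of $L_j\setminus\{0\}$ in at most one point, for every line $L_j$ of every one of its cycles. Let $X$ and $Y$ be two cycles of a simple heteroclinic network in $\mathbb{R}^4$. Then: 1. If $X$ is of type $A$, then $Y$ is of type $A$ (and not of type $B$ or $C$). 2. If $X$ is of type $B$, then either $Y$ is of type $B$ and has the same number of equilibria as $X$, or $X$ is of type $B_3^-$ and $Y$ is of type $C_4^-$. 3. If $X$ is of type $C$, then either $Y$ is of type $C$ and has the same number of equilibria as $X$, or $X$ is of type $C_4^-$ and $Y$ is of type $B_3^-$. -/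

import Mathlib

open Filter Topology

noncomputable section

/-- The phase space `ℝ⁴` with its Euclidean structure. -/
abbrev R4 : Type := EuclideanSpace ℝ (Fin 4)

/-- The orthogonal group `O(4)`, as the group of linear isometries of `ℝ⁴`. -/
abbrev O4 : Type := R4 ≃ₗᵢ[ℝ] R4

/-- `f` is `Γ`-equivariant. -/
def IsEquivariant (f : R4 → R4) (Γ : Subgroup O4) : Prop :=
  ∀ γ ∈ Γ, ∀ y : R4, f (γ y) = γ (f y)

/-- The isotropy subgroup of the point `x` in `Γ`. -/
def isotropy (Γ : Subgroup O4) (x : R4) : Subgroup O4 where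
  carrier := {γ | γ ∈ Γ ∧ γ x = x}
  mul_mem' := by
    rintro a b ⟨ha, hax⟩ ⟨hb, hbx⟩
    refine ⟨Γ.mul_mem ha hb, ?_⟩
    rw [LinearIsometryEquiv.coe_mul, Function.comp_apply, hbx, hax]
  one_mem' := ⟨Γ.one_mem, rfl⟩
  inv_mem' := by
    rintro a ⟨ha, hax⟩
    refine ⟨Γ.inv_mem ha, ?_⟩
    conv_lhs => rw [← hax]
    exact a.symm_apply_apply x

/-- The fixed-point subspace `Fix(S)`. -/
def fixSpace (S : Subgroup O4) : Submodule ℝ R4 where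
  carrier := {x | ∀ γ ∈ S, γ x = x}
  add_mem' := by
    intro a b ha hb γ hγ
    rw [map_add, ha γ hγ, hb γ hγ]
  zero_mem' := fun γ _ => map_zero γ
  smul_mem' := by
    intro c x hx γ hγ
    rw [map_smul, hx γ hγ]

/-- The group orbit of the point `x`. -/
def groupOrbit (Γ : Subgroup O4) (x : R4) : Set R4 := {y | ∃ γ ∈ Γ, y = γ x}

/-- The group orbit of the set `S`. -/
def groupOrbitSet (Γ : Subgroup O4) (S : Set R4) : Set R4 :=
  {y | ∃ γ ∈ Γ, ∃ x ∈ S, y = γ x}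

/-- The complex eigenvalues, with multiplicity, of a real endomorphism. -/
def complexEigenvalues {V : Type} [AddCommGroup V] [Module ℝ V] [Module.Finite ℝ V]
    (A : V →ₗ[ℝ] V) : Multiset ℂ :=
  (A.charpoly.map (algebraMap ℝ ℂ)).roots

/-- The linearization `df(ξ)`. -/
def linearization (f : R4 → R4) (ξ : R4) : R4 →ₗ[ℝ] R4 :=
  (fderiv ℝ f ξ : R4 →L[ℝ] R4)

/-- `ξ` is a sink for the restriction of `f` to `P`: the linearization maps `P` to itself, and
all eigenvalues of its restriction to `P` have negative real part. -/
def IsSinkIn (f : R4 → R4) (P : Submodule ℝ R4) (ξ : R4) : Prop :=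
  ξ ∈ P ∧ ∃ h : ∀ v ∈ P, linearization f ξ v ∈ P,
    ∀ μ ∈ complexEigenvalues ((linearization f ξ).restrict h), μ.re < 0

/-- `ξ` is a (hyperbolic) saddle for the restriction of `f` to `P`: the linearization maps `P`
to itself, no eigenvalue of its restriction to `P` lies on the imaginary axis, and there are
eigenvalues on both sides of it. -/
def IsSaddleIn (f : R4 → R4) (P : Submodule ℝ R4) (ξ : R4) : Prop :=
  ξ ∈ P ∧ ∃ h : ∀ v ∈ P, linearization f ξ v ∈ P,
    (∀ μ ∈ complexEigenvalues ((linearization f ξ).restrict h), μ.re ≠ 0) ∧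
    (∃ μ ∈ complexEigenvalues ((linearization f ξ).restrict h), 0 < μ.re) ∧
    (∃ μ ∈ complexEigenvalues ((linearization f ξ).restrict h), μ.re < 0)

/-- A robust heteroclinic cycle `ξ₁ → ξ₂ → ⋯ → ξₘ → ξ₁` of `ẏ = f(y)` with symmetry group `Γ`.
Nodes are indexed cyclically. The `j`-th connection is a full trajectory from the `j`-th node
to the next one; it is of saddle-sink type in the fixed-point space of the isotropy subgroup
`iso j`. The cycle is not homoclinic: its nodes do not all lie in one group orbit. -/
structure HeteroclinicCycle (f : R4 → R4) (Γ : Subgroup O4) where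
  /-- number of nodes -/
  len : ℕ
  /-- there is at least one node -/
  len_ne : NeZero len
  /-- the equilibria `ξ_j` -/
  node : ZMod len → R4
  /-- the connecting trajectories `[ξ_j → ξ_{j+1}]` -/
  conn : ZMod len → ℝ → R4
  /-- the isotropy subgroups `Σ_j` -/
  iso : ZMod len → Subgroup O4
  /-- the listed nodes are distinct -/
  node_injective : Function.Injective node
  /-- the nodes are equilibria -/
  node_equilibrium : ∀ j, f (node j) = 0
  /-- the connections solve the differential equation -/
  conn_solution : ∀ j t, HasDerivAt (conn j) (f (conn j t)) t
  /-- the connection lies in the unstable set of `ξ_j` -/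
  conn_atBot : ∀ j, Tendsto (conn j) atBot (𝓝 (node j))
  /-- the connection lies in the stable set of `ξ_{j+1}` -/
  conn_atTop : ∀ j, Tendsto (conn j) atTop (𝓝 (node (j + 1)))
  /-- the `Σ_j` are isotropy subgroups of `Γ` -/
  iso_isotropy : ∀ j, ∃ x, iso j = isotropy Γ x
  /-- the connection lies in `P_j = Fix(Σ_j)` -/
  conn_mem : ∀ j t, conn j t ∈ fixSpace (iso j)
  /-- `ξ_j` is a saddle in `P_j` -/
  saddle : ∀ j, IsSaddleIn f (fixSpace (iso j)) (node j)
  /-- `ξ_{j+1}` is a sink in `P_j` -/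
  sink : ∀ j, IsSinkIn f (fixSpace (iso j)) (node (j + 1))
  /-- the cycle is not homoclinic -/
  not_homoclinic : ¬ ∀ j, node j ∈ groupOrbit Γ (node 0)

namespace HeteroclinicCycle

variable {f : R4 → R4} {Γ : Subgroup O4}

/-- The cycle as a subset of `ℝ⁴`: all its nodes and connecting trajectories. -/
def carrier (X : HeteroclinicCycle f Γ) : Set R4 :=
  Set.range X.node ∪ ⋃ j, Set.range (X.conn j)

/-- `P_j = Fix(Σ_j)`. -/
def P (X : HeteroclinicCycle f Γ) (j : ZMod X.len) : Submodule ℝ R4 := fixSpace (X.iso j)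

/-- `L_j = P_{j-1} ∩ P_j`. -/
def L (X : HeteroclinicCycle f Γ) (j : ZMod X.len) : Submodule ℝ R4 := X.P (j - 1) ⊓ X.P j

/-- Number of distinct group orbits of equilibria in the cycle (the subscript of its type). -/
def numEquilibria (X : HeteroclinicCycle f Γ) : ℕ :=
  (Set.range fun j => groupOrbit Γ (X.node j)).ncard

end HeteroclinicCycle

/-- The group orbit of `S` meets each connected component of `L \ {0}` in at most one point. -/
def MeetsComponentsAtMostOnce (Γ : Subgroup O4) (S : Set R4) (L : Submodule ℝ R4) : Prop :=
  ∀ x ∈ (L : Set R4) \ {0},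
    (groupOrbitSet Γ S ∩ connectedComponentIn ((L : Set R4) \ {0}) x).Subsingleton

namespace HeteroclinicCycle

variable {f : R4 → R4} {Γ : Subgroup O4}

/-- Simple cycles: the cycle avoids the origin, all `P_j` are planes, the cycle (together with its
symmetric copies) meets each component of `L_j \ {0}` at most once, and the linearization at each
node has no multiple eigenvalue. -/
structure IsSimple (X : HeteroclinicCycle f Γ) : Prop where
  zero_notMem : (0 : R4) ∉ X.carrier
  finrank_P : ∀ j, Module.finrank ℝ (X.P j) = 2
  meets_L : ∀ j, MeetsComponentsAtMostOnce Γ X.carrier (X.L j)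
  eigenvalues_nodup : ∀ j, (complexEigenvalues (linearization f (X.node j))).Nodup

/-- Type A: `Σ_j ≅ ℤ₂` for all `j`. -/
def IsTypeA (X : HeteroclinicCycle f Γ) : Prop :=
  ∀ j, Nonempty (X.iso j ≃* Multiplicative (ZMod 2))

/-- Type B: the cycle lies in a three-dimensional fixed-point subspace. -/
def IsTypeB (X : HeteroclinicCycle f Γ) : Prop :=
  ∃ K : Subgroup O4, K ≤ Γ ∧ Module.finrank ℝ (fixSpace K) = 3 ∧
    X.carrier ⊆ (fixSpace K : Set R4)

/-- Type C: neither type A nor type B. -/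
def IsTypeC (X : HeteroclinicCycle f Γ) : Prop := ¬ X.IsTypeA ∧ ¬ X.IsTypeB

/-- Type `B₃⁻`: type B, three group orbits of equilibria, and `-Id ∈ Γ`. -/
def IsTypeB3Minus (X : HeteroclinicCycle f Γ) : Prop :=
  X.IsTypeB ∧ X.numEquilibria = 3 ∧ (LinearIsometryEquiv.neg ℝ : O4) ∈ Γ

/-- Type `C₄⁻`: type C, four group orbits of equilibria, and `-Id ∈ Γ`. -/
def IsTypeC4Minus (X : HeteroclinicCycle f Γ) : Prop :=
  X.IsTypeC ∧ X.numEquilibria = 4 ∧ (LinearIsometryEquiv.neg ℝ : O4) ∈ Γ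

end HeteroclinicCycle

/-- A simple heteroclinic network, given as a finite family of cycles: the union of the cycles is
connected, every cycle is simple, and the network (together with its symmetric copies) meets each
component of `L_j \ {0}` at most once, for the lines `L_j` of all its cycles. -/
structure IsSimpleNetwork {f : R4 → R4} {Γ : Subgroup O4} {ι : Type*}
    (X : ι → HeteroclinicCycle f Γ) : Prop where
  finite : Finite ι
  connected : IsConnected (⋃ k, (X k).carrier)
  simple : ∀ k, (X k).IsSimple
  meets_L : ∀ k j, MeetsComponentsAtMostOnce Γ (⋃ l, (X l).carrier) ((X k).L j)

end

/-! Call a unit normal of the mirror of a reflection in Γ a root. At each node of a simple cycle the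
linearization has four mutually orthogonal eigenvectors, on which the isotropy of the node acts by
signs (`exists_isNodeFrame`). As soon as a node lies on one mirror, its three non-radial
eigenvectors are roots, and the contracting one gives a mirror through the next node. Hence a simple
cycle is of type A exactly when none of its nodes lies on a mirror (`isTypeA_iff`). This is a
condition on single nodes, and by uniqueness of solutions cycles that meet share a node, so
connectedness spreads type A over the network.

For the remaining cycles, the point is that a connection never crosses a mirror. If consecutive
nodes are not on opposite half-lines, a minimisation over a finite orbit of roots shows that every
root lies in P_j or in its orthogonal complement (`IsUnitRoot.mem_or_mem_orthogonal`). Consequently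
consecutive nodes are opposite either always or never. In the first case the cycle has two nodes on
one line, is of type B with two equilibria, and -Id is not in Γ. In the second case the roots are,
up to sign, an orthonormal frame, so -Id is in Γ. Thus membership of -Id decides the case for all
these cycles at once.

In the second case all nodes lie on axes of the frame, any three consecutive ones on different axes.
Symmetric axes carry symmetric nodes, so equilibria are counted by the Γ-orbits of visited axes.
Type B means that some axis is never visited; then no two of the four axes are symmetric
(`groupOrbit_injective`), so such a cycle has three equilibria and a cycle visiting all axes has
four. Two cycles that both visit all axes have as many equilibria as there are orbits of axes. -/

open scoped InnerProductSpace

/-! ### Solutions of the differential equation -/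

/-- Two global solutions of an autonomous `C¹` equation that agree at one time agree always. -/
theorem solution_unique {f : R4 → R4} (hf : ContDiff ℝ 1 f) {u v : ℝ → R4}
    (hu : ∀ t, HasDerivAt u (f (u t)) t) (hv : ∀ t, HasDerivAt v (f (v t)) t)
    {a : ℝ} (h : u a = v a) : u = v := by
  have hcu : Continuous u := continuous_iff_continuousAt.2 fun t => (hu t).continuousAt
  have hcv : Continuous v := continuous_iff_continuousAt.2 fun t => (hv t).continuousAt
  have hclopen : IsClopen {t | u t = v t} := by
    refine ⟨isClosed_eq hcu hcv, isOpen_iff_mem_nhds.2 fun t (ht : u t = v t) => ?_⟩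
    obtain ⟨K, s, hs, hK⟩ := (hf.contDiffAt (x := u t)).exists_lipschitzOnWith
    have hs' : s ∈ 𝓝 (v t) := ht ▸ hs
    exact ODE_solution_unique_of_eventually (v := fun _ => f) (s := fun _ => s)
      (Eventually.of_forall fun _ => hK)
      ((hcu.continuousAt.eventually hs).mono fun r hr => ⟨hu r, hr⟩)
      ((hcv.continuousAt.eventually hs').mono fun r hr => ⟨hv r, hr⟩) ht
  have huniv := hclopen.eq_univ ⟨a, h⟩
  funext t
  exact (huniv ▸ Set.mem_univ t : t ∈ {t | u t = v t})

/-- The closure of a trajectory adds only its two limits. -/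
theorem closure_range_subset_of_tendsto {u : ℝ → R4} (hu : Continuous u) {p q : R4}
    (hp : Tendsto u atBot (𝓝 p)) (hq : Tendsto u atTop (𝓝 q)) :
    closure (Set.range u) ⊆ Set.range u ∪ {p, q} := by
  intro x hx
  obtain ⟨g, hg, hgx⟩ := mem_closure_iff_ultrafilter.1 hx
  obtain ⟨w, hw⟩ : ∃ w : Ultrafilter ℝ, w.map u = g := by
    have hne : (comap u (g : Filter R4)).NeBot :=
      NeBot.comap_of_range_mem inferInstance hg
    refine ⟨Ultrafilter.of (comap u (g : Filter R4)), ?_⟩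
    refine Ultrafilter.eq_of_le ?_
    rw [Ultrafilter.coe_map]
    exact (map_mono (Ultrafilter.of_le _)).trans map_comap_le
  have hwx : Tendsto u (w : Filter ℝ) (𝓝 x) := by
    rw [Tendsto, ← Ultrafilter.coe_map, hw]; exact hgx
  -- Either the times escape to one of the two ends of the line, where the limit is `p` or `q`, or
  -- they stay in a compact set and accumulate at a finite time.
  by_cases hc : (w : Filter ℝ) ≤ cocompact ℝ
  · rw [cocompact_eq_atBot_atTop] at hc
    rcases Ultrafilter.le_sup_iff.1 hc with hc | hc
    · exact Or.inr (Or.inl (tendsto_nhds_unique hwx (hp.mono_left hc)))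
    · exact Or.inr (Or.inr (tendsto_nhds_unique hwx (hq.mono_left hc)))
  · obtain ⟨s, hs, hsw⟩ := Filter.not_le.1 hc
    obtain ⟨K, hK, hKs⟩ := mem_cocompact.1 hs
    have hKw : K ∈ w := by
      by_contra hn
      exact hsw (mem_of_superset (Ultrafilter.compl_mem_iff_notMem.2 hn) hKs)
    obtain ⟨t, -, ht⟩ := hK.ultrafilter_le_nhds w (le_principal_iff.2 hKw)
    exact Or.inl ⟨t, tendsto_nhds_unique ((hu.tendsto t).mono_left ht) hwx⟩

/-- Equivariance of the linearization. -/
theorem linearization_map {f : R4 → R4} (hf : ContDiff ℝ 1 f) {Γ : Subgroup O4}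
    (hΓ : IsEquivariant f Γ) {γ : O4} (hγ : γ ∈ Γ) (ξ v : R4) :
    linearization f (γ ξ) (γ v) = γ (linearization f ξ v) := by
  have hd : Differentiable ℝ f := hf.differentiable one_ne_zero
  have hγd (x : R4) : HasFDerivAt γ (γ.toContinuousLinearEquiv : R4 →L[ℝ] R4) x :=
    γ.toContinuousLinearEquiv.hasFDerivAt
  have h1 := (hd (γ ξ)).hasFDerivAt.comp ξ (hγd ξ)
  have h2 := (hγd (f ξ)).comp ξ (hd ξ).hasFDerivAt
  have h3 : f ∘ γ = γ ∘ f := funext fun y => hΓ γ hγ y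
  rw [h3] at h1
  exact congrArg (fun T : R4 →L[ℝ] R4 => T v) (h1.unique h2)

/-- A solution that starts on the mirror of a symmetry stays there. -/
theorem map_solution_eq {f : R4 → R4} (hf : ContDiff ℝ 1 f) {Γ : Subgroup O4}
    (hΓ : IsEquivariant f Γ) {γ : O4} (hγ : γ ∈ Γ) {u : ℝ → R4}
    (hu : ∀ t, HasDerivAt u (f (u t)) t) {a : ℝ} (ha : γ (u a) = u a) (t : ℝ) :
    γ (u t) = u t := by
  have hv : ∀ t, HasDerivAt (fun s => γ (u s)) (f (γ (u t))) t := fun t => by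
    rw [hΓ γ hγ]
    exact (γ.toContinuousLinearEquiv.hasFDerivAt (x := u t)).comp_hasDerivAt t (hu t)
  exact congrFun (solution_unique hf hv hu ha) t

/-! ### Cycles as sets -/

namespace HeteroclinicCycle

variable {f : R4 → R4} {Γ : Subgroup O4}

instance (X : HeteroclinicCycle f Γ) : NeZero X.len := X.len_ne

theorem continuous_conn (X : HeteroclinicCycle f Γ) (j : ZMod X.len) : Continuous (X.conn j) :=
  continuous_iff_continuousAt.2 fun t => (X.conn_solution j t).continuousAt

/-- There are finitely many connections, and the limits of each are nodes. Closedness is what turns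
connectedness of the network into intersections of cycles. -/
theorem isClosed_carrier (X : HeteroclinicCycle f Γ) : IsClosed X.carrier := by
  refine isClosed_of_closure_subset ?_
  rw [carrier, closure_union, closure_iUnion_of_finite, (Set.finite_range X.node).isClosed.closure_eq]
  refine Set.union_subset Set.subset_union_left (Set.iUnion_subset fun j => ?_)
  refine (closure_range_subset_of_tendsto (X.continuous_conn j) (X.conn_atBot j)
    (X.conn_atTop j)).trans (Set.union_subset ?_ ?_)
  · exact (Set.subset_iUnion (fun j => Set.range (X.conn j)) j).trans Set.subset_union_right
  · rintro x (rfl | rfl)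
    · exact Or.inl ⟨j, rfl⟩
    · exact Or.inl ⟨j + 1, rfl⟩

/-- A property that is passed on from each node to the next holds at all nodes or at none. -/
theorem forall_of_succ (X : HeteroclinicCycle f Γ) {p : ZMod X.len → Prop}
    (h : ∀ j, p j → p (j + 1)) {i : ZMod X.len} (hi : p i) (j : ZMod X.len) : p j := by
  have key : ∀ n : ℕ, p (i + n) := fun n => by
    induction n with
    | zero => simpa using hi
    | succ n ih => simpa [add_assoc] using h _ ih
  have := key (j - i).val
  rwa [ZMod.natCast_zmod_val, add_sub_cancel] at this

theorem one_ne_zero_zmod_len (X : HeteroclinicCycle f Γ) : (1 : ZMod X.len) ≠ 0 := by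
  intro h
  refine X.not_homoclinic fun j => ⟨1, Γ.one_mem, ?_⟩
  have hj : j = 0 := by rw [← mul_one j, h, mul_zero]
  rw [hj]; rfl

theorem node_succ_ne (X : HeteroclinicCycle f Γ) (j : ZMod X.len) : X.node (j + 1) ≠ X.node j :=
  fun h => X.one_ne_zero_zmod_len (by simpa using X.node_injective h)

/-- A trajectory through an equilibrium is constant, so its two limits would coincide; but
consecutive nodes differ. -/
theorem conn_ne_equilibrium (X : HeteroclinicCycle f Γ) (hf : ContDiff ℝ 1 f) {ξ : R4}
    (hξ : f ξ = 0) (j : ZMod X.len) (t : ℝ) : X.conn j t ≠ ξ := by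
  intro h
  have hc : ∀ s : ℝ, HasDerivAt (fun _ : ℝ => ξ) (f ξ) s := fun s => by
    rw [hξ]; exact hasDerivAt_const s ξ
  have he := solution_unique hf (X.conn_solution j) hc h
  have h1 := X.conn_atBot j
  have h2 := X.conn_atTop j
  rw [he] at h1 h2
  exact X.node_succ_ne j ((tendsto_nhds_unique h2 tendsto_const_nhds).trans
    (tendsto_nhds_unique h1 tendsto_const_nhds).symm)

/-- Cycles of the same vector field that meet have a common node. -/
theorem exists_node_eq_of_mem (X Y : HeteroclinicCycle f Γ) (hf : ContDiff ℝ 1 f) {x : R4}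
    (hx : x ∈ X.carrier) (hy : x ∈ Y.carrier) : ∃ i j, X.node i = Y.node j := by
  rcases hx with ⟨i, hi⟩ | hx <;> rcases hy with ⟨j, hj⟩ | hy
  · exact ⟨i, j, hi.trans hj.symm⟩
  · obtain ⟨j, t, ht⟩ := Set.mem_iUnion.1 hy
    exact (Y.conn_ne_equilibrium hf (X.node_equilibrium i) j t (ht.trans hi.symm)).elim
  · obtain ⟨i, t, ht⟩ := Set.mem_iUnion.1 hx
    exact (X.conn_ne_equilibrium hf (Y.node_equilibrium j) i t (ht.trans hj.symm)).elim
  · obtain ⟨i, s, hs⟩ := Set.mem_iUnion.1 hx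
    obtain ⟨j, t, ht⟩ := Set.mem_iUnion.1 hy
    have h1 : ∀ r, HasDerivAt (fun r => Y.conn j (r + (t - s))) (f (Y.conn j (r + (t - s)))) r :=
      fun r => (Y.conn_solution j _).comp_add_const r (t - s)
    have h2 := solution_unique hf (X.conn_solution i) h1 (a := s)
      (by rw [hs, add_sub_cancel, ht])
    refine ⟨i, j, tendsto_nhds_unique (X.conn_atBot i) ?_⟩
    rw [h2]
    exact (Y.conn_atBot j).comp (tendsto_atBot_add_const_right _ _ tendsto_id)

end HeteroclinicCycle

/-- In a simple network, a property of cycles that is passed on between cycles with a common node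
holds for all cycles or for none. -/
theorem IsSimpleNetwork.forall_of_node_eq {f : R4 → R4} (hf : ContDiff ℝ 1 f) {Γ : Subgroup O4}
    {ι : Type*} {X : ι → HeteroclinicCycle f Γ} (hX : IsSimpleNetwork X)
    {p : ι → Prop} (h : ∀ k l i j, (X k).node i = (X l).node j → p k → p l)
    {k : ι} (hk : p k) (l : ι) : p l := by
  by_contra hl
  have := hX.finite
  have hcl : ∀ q : ι → Prop, IsClosed (⋃ k : {k // q k}, (X k).carrier) := fun q =>
    isClosed_iUnion_of_finite fun k => (X k).isClosed_carrier
  have hne : ∀ k, ∃ x, x ∈ (X k).carrier := fun k => ⟨_, Or.inl ⟨0, rfl⟩⟩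
  -- The cycles with `p` and those without it form two nonempty closed sets covering the network. A
  -- common point yields a common node.
  obtain ⟨x, -, hx1, hx2⟩ := isPreconnected_closed_iff.1 hX.connected.isPreconnected _ _
    (hcl p) (hcl fun k => ¬ p k) (by
      intro x hx
      obtain ⟨m, hm⟩ := Set.mem_iUnion.1 hx
      by_cases hp : p m
      · exact Or.inl (Set.mem_iUnion.2 ⟨⟨m, hp⟩, hm⟩)
      · exact Or.inr (Set.mem_iUnion.2 ⟨⟨m, hp⟩, hm⟩))
    (by
      obtain ⟨x, hx⟩ := hne k
      exact ⟨x, Set.mem_iUnion.2 ⟨k, hx⟩, Set.mem_iUnion.2 ⟨⟨k, hk⟩, hx⟩⟩)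
    (by
      obtain ⟨x, hx⟩ := hne l
      exact ⟨x, Set.mem_iUnion.2 ⟨l, hx⟩, Set.mem_iUnion.2 ⟨⟨l, hl⟩, hx⟩⟩)
  obtain ⟨⟨a, ha⟩, hxa⟩ := Set.mem_iUnion.1 hx1
  obtain ⟨⟨b, hb⟩, hxb⟩ := Set.mem_iUnion.1 hx2
  obtain ⟨i, j, hij⟩ := (X a).exists_node_eq_of_mem (X b) hf hxa hxb
  exact hb (h a b i j hij ha)

/-- Two points of the orbit of `S` on a common open half-line in `L` coincide. -/
theorem MeetsComponentsAtMostOnce.eq_of_smul {Γ : Subgroup O4} {S : Set R4} {L : Submodule ℝ R4}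
    (h : MeetsComponentsAtMostOnce Γ S L) {x : R4} (hxL : x ∈ L) (hx0 : x ≠ 0)
    (hx : x ∈ groupOrbitSet Γ S) {c : ℝ} (hc : 0 < c) (hcx : c • x ∈ groupOrbitSet Γ S) :
    c • x = x := by
  have hmem : x ∈ (L : Set R4) \ {0} := ⟨hxL, hx0⟩
  refine h x hmem ⟨hcx, ?_⟩ ⟨hx, mem_connectedComponentIn hmem⟩
  have hpre : IsPreconnected ((fun r : ℝ => r • x) '' Set.Ioi 0) :=
    isPreconnected_Ioi.image _ (by fun_prop)
  refine hpre.subset_connectedComponentIn ⟨1, Set.mem_Ioi.2 zero_lt_one, one_smul ℝ x⟩ ?_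
    ⟨c, hc, rfl⟩
  rintro _ ⟨r, hr, rfl⟩
  exact ⟨L.smul_mem r hxL, smul_ne_zero (ne_of_gt hr) hx0⟩

/-! ### Eigenvalues at a node -/

theorem charpoly_eq_prod_of_triangular {V : Type} [AddCommGroup V] [Module ℝ V]
    [Module.Finite ℝ V] {n : ℕ} (B : Module.Basis (Fin n) ℝ V) (A : V →ₗ[ℝ] V)
    (h : ∀ i j, j < i → B.repr (A (B j)) i = 0) :
    A.charpoly = ∏ i, (Polynomial.X - Polynomial.C (B.repr (A (B i)) i)) := by
  rw [← LinearMap.charpoly_toMatrix A B, Matrix.charpoly_of_isUpperTriangular]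
  · simp [LinearMap.toMatrix_apply]
  · intro i j hij
    rw [LinearMap.toMatrix_apply]
    exact h i j hij

theorem complexEigenvalues_of_triangular {V : Type} [AddCommGroup V] [Module ℝ V]
    [Module.Finite ℝ V] {n : ℕ} (B : Module.Basis (Fin n) ℝ V) (A : V →ₗ[ℝ] V)
    (h : ∀ i j, j < i → B.repr (A (B j)) i = 0) :
    complexEigenvalues A = Finset.univ.val.map fun i => ((B.repr (A (B i)) i : ℝ) : ℂ) := by
  rw [complexEigenvalues, charpoly_eq_prod_of_triangular B A h, Polynomial.map_prod]
  simp only [Polynomial.map_sub, Polynomial.map_X, Polynomial.map_C]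
  rw [← Polynomial.roots_multiset_prod_X_sub_C
    (Finset.univ.val.map fun i => ((B.repr (A (B i)) i : ℝ) : ℂ)), Multiset.map_map]
  rfl

/-- A plane through `ξ` has a basis starting with `ξ`. -/
theorem exists_basis_of_finrank_eq_two {P : Submodule ℝ R4} (hP : Module.finrank ℝ P = 2)
    {ξ : R4} (hξ : ξ ∈ P) (h0 : ξ ≠ 0) :
    ∃ B : Module.Basis (Fin 2) ℝ P, (B 0 : R4) = ξ := by
  obtain ⟨y, hy⟩ := exists_linearIndependent_pair_of_one_lt_finrank (R := ℝ) (M := P)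
    (by rw [hP]; norm_num) (x := ⟨ξ, hξ⟩) (by simpa using h0)
  refine ⟨basisOfLinearIndependentOfCardEqFinrank hy (by simp [hP]), by simp⟩

/-- The restriction to a plane of an operator with eigenvector `ξ` has two real eigenvalues. -/
theorem exists_mem_complexEigenvalues_restrict {P : Submodule ℝ R4}
    {ξ u : R4} (B : Module.Basis (Fin 2) ℝ P) (hB0 : (B 0 : R4) = ξ) (hB1 : (B 1 : R4) = u)
    {A : R4 →ₗ[ℝ] R4} (h : ∀ v ∈ P, A v ∈ P) {r : ℝ} (hr : A ξ = r • ξ) :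
    ∃ s c : ℝ, A u = s • ξ + c • u ∧
      ∀ μ : ℂ, μ ∈ complexEigenvalues (A.restrict h) ↔ μ = r ∨ μ = c := by
  have h0 : A.restrict h (B 0) = r • B 0 := by
    ext1; simp [hB0, hr]
  refine ⟨B.repr (A.restrict h (B 1)) 0, B.repr (A.restrict h (B 1)) 1, ?_, fun μ => ?_⟩
  · have := congrArg (Subtype.val) (B.sum_repr (A.restrict h (B 1)))
    rw [Fin.sum_univ_two] at this
    simp only [Submodule.coe_add, Submodule.coe_smul, hB0, hB1] at this
    rw [this, LinearMap.coe_restrict_apply, hB1]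
  · rw [complexEigenvalues_of_triangular B]
    · simp only [Multiset.mem_map, Finset.mem_val, Finset.mem_univ, true_and, Fin.exists_fin_two,
        h0, map_smul, Module.Basis.repr_self]
      simp [eq_comm]
    · intro i j hij
      have hi : i = 1 := by omega
      have hj : j = 0 := by omega
      subst hi hj
      simp [h0]

/-- At a node with a plane in which it is a sink, a plane in which it is a saddle, and simple
spectrum, there are real eigenvectors: the node, one more in each of the planes, and a fourth. -/
theorem exists_eigenvectors {f : R4 → R4} {P P' : Submodule ℝ R4} {ξ : R4} (h0 : ξ ≠ 0)
    (hP : Module.finrank ℝ P = 2) (hP' : Module.finrank ℝ P' = 2)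
    (hsink : IsSinkIn f P ξ) (hsaddle : IsSaddleIn f P' ξ)
    (hnd : (complexEigenvalues (linearization f ξ)).Nodup) :
    ∃ (x : Fin 4 → R4) (μ : Fin 4 → ℝ), Function.Injective μ ∧
      (∀ i, x i ≠ 0 ∧ linearization f ξ (x i) = μ i • x i) ∧ x 0 = ξ ∧ x 1 ∈ P ∧ x 2 ∈ P' ∧
      μ 1 < 0 ∧ 0 < μ 2 := by
  obtain ⟨hξ, hA, hneg⟩ := hsink
  obtain ⟨hξ', hA', -, ⟨μp, hμp, hpos⟩, -⟩ := hsaddle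
  set A := linearization f ξ with hAdef
  have hne : P ≠ P' := by
    rintro rfl
    exact lt_asymm hpos (hneg _ hμp)
  obtain ⟨B, hB⟩ := exists_basis_of_finrank_eq_two hP hξ h0
  obtain ⟨B', hB'⟩ := exists_basis_of_finrank_eq_two hP' hξ' h0
  obtain ⟨u, hu⟩ : ∃ u, (B 1 : R4) = u := ⟨_, rfl⟩
  obtain ⟨v, hv⟩ : ∃ v, (B' 1 : R4) = v := ⟨_, rfl⟩
  have huP : u ∈ P := hu ▸ (B 1).2
  have hvP' : v ∈ P' := hv ▸ (B' 1).2
  have hspan : ∀ y ∈ P, ∃ a b : ℝ, y = a • ξ + b • u := fun y hy => by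
    have := congrArg (Subtype.val) (B.sum_repr ⟨y, hy⟩)
    rw [Fin.sum_univ_two] at this
    simp only [Submodule.coe_add, Submodule.coe_smul, hB, hu] at this
    exact ⟨_, _, this.symm⟩
  have hspan' : ∀ y ∈ P', ∃ a b : ℝ, y = a • ξ + b • v := fun y hy => by
    have := congrArg (Subtype.val) (B'.sum_repr ⟨y, hy⟩)
    rw [Fin.sum_univ_two] at this
    simp only [Submodule.coe_add, Submodule.coe_smul, hB', hv] at this
    exact ⟨_, _, this.symm⟩
  have hvP : v ∉ P := by
    intro hvP
    refine hne (Submodule.eq_of_le_of_finrank_eq ?_ (hP'.trans hP.symm)).symm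
    intro y hy
    obtain ⟨a, b, rfl⟩ := hspan' y hy
    exact P.add_mem (P.smul_mem _ hξ) (P.smul_mem _ hvP)
  have hli2 : LinearIndependent ℝ ![ξ, u] := by
    have := B.linearIndependent.map' P.subtype P.ker_subtype
    have he : ![ξ, u] = P.subtype ∘ B := by
      funext i
      fin_cases i <;> simp [hB, hu]
    rwa [he]
  have hli3 : LinearIndependent ℝ (Fin.snoc ![ξ, u] v : Fin 3 → R4) := by
    rw [linearIndependent_finSnoc]
    refine ⟨hli2, fun hmem => hvP ?_⟩
    refine (Submodule.span_le.2 ?_ : Submodule.span ℝ (Set.range ![ξ, u]) ≤ P) hmem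
    rintro _ ⟨i, rfl⟩
    fin_cases i
    · exact hξ
    · exact huP
  obtain ⟨w, hw⟩ := exists_linearIndependent_snoc_of_lt_finrank (R := ℝ) hli3 (by simp)
  let b4 : Module.Basis (Fin 4) ℝ R4 := basisOfLinearIndependentOfCardEqFinrank hw (by simp)
  have e0 : b4 0 = ξ := by
    simp only [b4, coe_basisOfLinearIndependentOfCardEqFinrank]; rfl
  have e1 : b4 1 = u := by
    simp only [b4, coe_basisOfLinearIndependentOfCardEqFinrank]; rfl
  have e2 : b4 2 = v := by
    simp only [b4, coe_basisOfLinearIndependentOfCardEqFinrank]; rfl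
  have r0 : b4.repr ξ = Finsupp.single 0 1 := by rw [← e0, Module.Basis.repr_self]
  have r1 : b4.repr u = Finsupp.single 1 1 := by rw [← e1, Module.Basis.repr_self]
  have r2 : b4.repr v = Finsupp.single 2 1 := by rw [← e2, Module.Basis.repr_self]
  -- Both planes are invariant, and they intersect only in the line of `ξ`.
  obtain ⟨r, hr⟩ : ∃ r : ℝ, A ξ = r • ξ := by
    obtain ⟨a, b, hab⟩ := hspan _ (hA ξ hξ)
    obtain ⟨a', b', hab'⟩ := hspan' _ (hA' ξ hξ')
    have hb : b = 0 := by
      have := congrArg (fun y => b4.repr y 1) (hab.symm.trans hab')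
      simpa [r0, r1, r2] using this
    exact ⟨a, by rw [hab, hb, zero_smul, add_zero]⟩
  obtain ⟨s, c, hs, hspec⟩ := exists_mem_complexEigenvalues_restrict B hB hu hA hr
  obtain ⟨s', e, hs', hspec'⟩ := exists_mem_complexEigenvalues_restrict B' hB' hv hA' hr
  have hr0 : r < 0 := by simpa using hneg r ((hspec r).2 (Or.inl rfl))
  have hc0 : c < 0 := by simpa using hneg c ((hspec c).2 (Or.inr rfl))
  -- The sink makes `r` negative, so the unstable eigenvalue in the saddle plane must be the other
  -- one. In particular all eigenvalues met so far are real.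
  have he0 : 0 < e := by
    rcases (hspec' μp).1 hμp with h | h
    · rw [h, Complex.ofReal_re] at hpos; exact absurd hpos (not_lt.2 hr0.le)
    · rw [h, Complex.ofReal_re] at hpos; exact hpos
  have htri : ∀ i j : Fin 4, j < i → b4.repr (A (b4 j)) i = 0 := by
    intro i j hij
    fin_cases j
    · have hi : i ≠ 0 := by rintro rfl; simp at hij
      simp [e0, hr, r0, hi.symm]
    · have hi : i ≠ 0 := by rintro rfl; simp at hij
      have hi1 : i ≠ 1 := by rintro rfl; simp at hij
      simp [e1, hs, r0, hi.symm, hi1.symm, r1]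
    · have hi : i = 3 := by
        have : (2 : Fin 4) < i := hij
        omega
      subst hi
      simp [e2, hs', r0, r2]
    · exfalso
      have : (3 : Fin 4) < i := hij
      omega
  have hchar := charpoly_eq_prod_of_triangular b4 A htri
  rw [complexEigenvalues_of_triangular b4 A htri] at hnd
  have d0 : b4.repr (A (b4 0)) 0 = r := by simp [e0, hr, r0]
  have d1 : b4.repr (A (b4 1)) 1 = c := by simp [e1, hs, r0, r1]
  have d2 : b4.repr (A (b4 2)) 2 = e := by simp [e2, hs', r0, r2]
  set μ : Fin 4 → ℝ := fun i => b4.repr (A (b4 i)) i with hμ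
  have hinj : Function.Injective μ := fun i j hij =>
    Multiset.inj_on_of_nodup_map hnd i (Finset.mem_univ i) j (Finset.mem_univ j)
      (congrArg Complex.ofReal hij)
  have hrc : c - r ≠ 0 := by
    rw [sub_ne_zero, ← d0, ← d1]; exact hinj.ne (by decide)
  have hre : e - r ≠ 0 := by
    rw [sub_ne_zero, ← d0, ← d2]; exact hinj.ne (by decide)
  -- The matrix in the basis `ξ, u, v, w` is upper triangular, so its last diagonal entry is an
  -- eigenvalue as well.
  obtain ⟨y, hy⟩ : ∃ y, Module.End.HasEigenvector A (μ 3) y := by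
    refine ((Module.End.hasEigenvalue_iff_isRoot_charpoly A (μ 3)).2 ?_).exists_hasEigenvector
    rw [hchar, Polynomial.IsRoot, Polynomial.eval_prod]
    exact Finset.prod_eq_zero (Finset.mem_univ 3) (by simp [hμ])
  -- The multiples of `ξ` cancel the off-diagonal entries `s` and `s'` and leave the vectors in
  -- their planes.
  refine ⟨![ξ, u + (s / (c - r)) • ξ, v + (s' / (e - r)) • ξ, y], μ, hinj, ?_, rfl, ?_, ?_,
    d1.trans_lt hc0, he0.trans_eq d2.symm⟩
  · intro i
    fin_cases i
    · exact ⟨h0, by change A ξ = μ 0 • ξ; rw [hr, ← d0]⟩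
    · constructor
      · intro h
        have := congrArg (fun y => b4.repr y 1) h
        simp [r0, r1] at this
      · change A (u + (s / (c - r)) • ξ) = μ 1 • (u + (s / (c - r)) • ξ)
        have : μ 1 = c := d1
        rw [map_add, map_smul, hr, hs, this]
        match_scalars <;> field_simp
        ring
    · constructor
      · intro h
        have := congrArg (fun y => b4.repr y 2) h
        simp [r0, r2] at this
      · change A (v + (s' / (e - r)) • ξ) = μ 2 • (v + (s' / (e - r)) • ξ)
        have : μ 2 = e := d2
        rw [map_add, map_smul, hr, hs', this]
        match_scalars <;> field_simp
        ring
    · exact ⟨hy.2, hy.apply_eq_smul⟩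
  · exact P.add_mem huP (P.smul_mem _ hξ)
  · exact P'.add_mem hvP' (P'.smul_mem _ hξ')

/-! ### Adapted frames -/

/-- `Γ` contains the map that multiplies the `i`-th vector of the frame `b` by `ε i`. -/
def HasDiagonal (Γ : Subgroup O4) (b : OrthonormalBasis (Fin 4) ℝ R4) (ε : Fin 4 → ℝ) : Prop :=
  ∃ γ ∈ Γ, ∀ i, γ (b i) = ε i • b i

/-- An orthonormal frame adapted to the node `ξ` with incoming plane `P` and outgoing plane `P'`:
it consists of the radial, contracting, expanding and transverse eigenvectors of the
linearization. -/
structure IsNodeFrame (f : R4 → R4) (Γ : Subgroup O4) (ξ : R4) (P P' : Submodule ℝ R4)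
    (b : OrthonormalBasis (Fin 4) ℝ R4) : Prop where
  node_eq : ξ = ‖ξ‖ • b 0
  mem_in : ∀ x, x ∈ P ↔ ⟪b 2, x⟫_ℝ = 0 ∧ ⟪b 3, x⟫_ℝ = 0
  mem_out : ∀ x, x ∈ P' ↔ ⟪b 1, x⟫_ℝ = 0 ∧ ⟪b 3, x⟫_ℝ = 0
  sign : ∀ γ ∈ Γ, γ ξ = ξ → ∀ i, γ (b i) = b i ∨ γ (b i) = -b i
  half_turn_in : HasDiagonal Γ b ![1, 1, -1, -1]
  half_turn_out : HasDiagonal Γ b ![1, -1, 1, -1]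
  eigen : ∃ μ : Fin 4 → ℝ, (∀ i, linearization f ξ (b i) = μ i • b i) ∧ μ 1 < 0 ∧ 0 < μ 2

theorem HasDiagonal.mul {Γ : Subgroup O4} {b : OrthonormalBasis (Fin 4) ℝ R4} {ε η : Fin 4 → ℝ}
    (hε : HasDiagonal Γ b ε) (hη : HasDiagonal Γ b η) : HasDiagonal Γ b (ε * η) := by
  obtain ⟨γ, hγ, h⟩ := hε
  obtain ⟨γ', hγ', h'⟩ := hη
  refine ⟨γ * γ', Γ.mul_mem hγ hγ', fun i => ?_⟩
  rw [LinearIsometryEquiv.coe_mul, Function.comp_apply, h', map_smul, h, smul_smul, Pi.mul_apply,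
    mul_comm]

theorem OrthonormalBasis.sum_four (b : OrthonormalBasis (Fin 4) ℝ R4) (x : R4) :
    x = ⟪b 0, x⟫_ℝ • b 0 + ⟪b 1, x⟫_ℝ • b 1 + ⟪b 2, x⟫_ℝ • b 2 + ⟪b 3, x⟫_ℝ • b 3 := by
  conv_lhs => rw [← b.sum_repr' x, Fin.sum_univ_four]

theorem OrthonormalBasis.inner_of_ne (b : OrthonormalBasis (Fin 4) ℝ R4) {i j : Fin 4}
    (h : i ≠ j) : ⟪b i, b j⟫_ℝ = 0 := b.orthonormal.2 h

theorem OrthonormalBasis.inner_self_one (b : OrthonormalBasis (Fin 4) ℝ R4) (i : Fin 4) :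
    ⟪b i, b i⟫_ℝ = 1 := by
  rw [real_inner_self_eq_norm_sq, b.orthonormal.1 i, one_pow]

theorem isometry_ext {b : OrthonormalBasis (Fin 4) ℝ R4} {γ γ' : O4}
    (h : ∀ i, γ (b i) = γ' (b i)) : γ = γ' := by
  ext1 x
  rw [b.sum_four x]
  simp only [map_add, map_smul, h]

theorem notMem_of_linearIndependent {P : Submodule ℝ R4} (hP : Module.finrank ℝ P = 2)
    {x : Fin 4 → R4} (hx : LinearIndependent ℝ x) {i j k : Fin 4} (hij : i ≠ j) (hik : i ≠ k)
    (hjk : j ≠ k) (hi : x i ∈ P) (hj : x j ∈ P) : x k ∉ P := by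
  intro hk
  have hinj : Function.Injective ![i, j, k] := by
    intro a b
    fin_cases a <;> fin_cases b <;> simp [hij, hik, hjk, hij.symm, hik.symm, hjk.symm]
  have hmem : ∀ a, x (![i, j, k] a) ∈ P := by
    intro a
    fin_cases a
    exacts [hi, hj, hk]
  have hli : LinearIndependent ℝ (fun a => (⟨x (![i, j, k] a), hmem a⟩ : P)) :=
    LinearIndependent.of_comp P.subtype (hx.comp _ hinj)
  have := hli.fintype_card_le_finrank
  rw [hP] at this
  simp at this

theorem exists_map_eq_neg {S : Subgroup O4} {y : R4} (hy : y ∉ fixSpace S)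
    (h : ∀ σ ∈ S, σ y = y ∨ σ y = -y) : ∃ σ ∈ S, σ y = -y := by
  by_contra hcon
  push Not at hcon
  exact hy fun σ hσ => (h σ hσ).resolve_right (hcon σ hσ)

theorem inner_eq_zero_of_map_eq_neg {σ : O4} {y z : R4} (hy : σ y = -y) (hz : σ z = z) :
    ⟪y, z⟫_ℝ = 0 := by
  have h := σ.inner_map_map y z
  rw [hy, hz, inner_neg_left] at h
  linarith

/-- A node as in a simple cycle has an adapted frame. -/
theorem exists_isNodeFrame {f : R4 → R4} (hf : ContDiff ℝ 1 f) {Γ : Subgroup O4}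
    (hΓ : IsEquivariant f Γ) {ξ : R4} (h0 : ξ ≠ 0) {S S' : Subgroup O4} (hS : S ≤ Γ)
    (hS' : S' ≤ Γ) (hP : Module.finrank ℝ (fixSpace S) = 2)
    (hP' : Module.finrank ℝ (fixSpace S') = 2)
    (hsink : IsSinkIn f (fixSpace S) ξ) (hsaddle : IsSaddleIn f (fixSpace S') ξ)
    (hnd : (complexEigenvalues (linearization f ξ)).Nodup) :
    ∃ b, IsNodeFrame f Γ ξ (fixSpace S) (fixSpace S') b := by
  obtain ⟨x, μ, hμ, hx, hx0, hx1, hx2, hμ1, hμ2⟩ :=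
    exists_eigenvectors h0 hP hP' hsink hsaddle hnd
  have hξ : x 0 ∈ fixSpace S := hx0 ▸ hsink.1
  have hξ' : x 0 ∈ fixSpace S' := hx0 ▸ hsaddle.1
  have hli : LinearIndependent ℝ x :=
    Module.End.eigenvectors_linearIndependent' (linearization f ξ) μ hμ x fun i =>
      Module.End.hasEigenvector_iff.2 ⟨Module.End.mem_eigenspace_iff.2 (hx i).2, (hx i).1⟩
  let B : Module.Basis (Fin 4) ℝ R4 := basisOfLinearIndependentOfCardEqFinrank hli (by simp)
  have hB : ∀ i, B i = x i := fun i => by simp [B]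
  have hline : ∀ i y, linearization f ξ y = μ i • y → ∃ c : ℝ, y = c • x i := by
    intro i y hy
    refine ⟨B.repr y i, B.ext_elem fun k => ?_⟩
    have hrepr : B.repr (linearization f ξ y) k = μ k * B.repr y k := by
      conv_lhs => rw [← B.sum_repr y]
      simp [hB, (hx _).2]
      simp [← hB, Finsupp.single_apply, mul_comm]
    rw [hy] at hrepr
    by_cases hik : i = k
    · subst hik
      simp [← hB]
    · have hne := sub_ne_zero.2 (hμ.ne hik)
      have : (μ i - μ k) * B.repr y k = 0 := by
        simp only [map_smul, Finsupp.smul_apply, smul_eq_mul] at hrepr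
        linear_combination hrepr
      simp [← hB, hik, (mul_eq_zero.1 this).resolve_left hne]
  -- The isotropy of `ξ` commutes with the linearization, hence preserves its one-dimensional
  -- eigenspaces, on which an isometry is a sign.
  have hsign : ∀ γ ∈ Γ, γ ξ = ξ → ∀ i, γ (x i) = x i ∨ γ (x i) = -x i := by
    intro γ hγ hγξ i
    have hlin := linearization_map hf hΓ hγ ξ (x i)
    rw [hγξ, (hx i).2, map_smul] at hlin
    obtain ⟨c, hc⟩ := hline i _ hlin
    have hn := γ.norm_map (x i)
    rw [hc, norm_smul, Real.norm_eq_abs] at hn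
    have hc1 : |c| = 1 := by
      have := norm_ne_zero_iff.2 (hx i).1
      field_simp at hn
      exact hn
    rcases (abs_eq zero_le_one).1 hc1 with h | h
    · exact Or.inl (by rw [hc, h, one_smul])
    · exact Or.inr (by rw [hc, h, neg_one_smul])
  have hsS : ∀ i, ∀ σ ∈ S, σ (x i) = x i ∨ σ (x i) = -x i := fun i σ hσ =>
    hsign σ (hS hσ) (hsink.1 σ hσ) i
  have hsS' : ∀ i, ∀ σ ∈ S', σ (x i) = x i ∨ σ (x i) = -x i := fun i σ hσ =>
    hsign σ (hS' hσ) (hsaddle.1 σ hσ) i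
  obtain ⟨σ₂, hσ₂, hσ₂x⟩ := exists_map_eq_neg (notMem_of_linearIndependent hP hli
    (i := 0) (j := 1) (k := 2) (by decide) (by decide) (by decide) hξ hx1) (hsS 2)
  obtain ⟨σ₃, hσ₃, hσ₃x⟩ := exists_map_eq_neg (notMem_of_linearIndependent hP hli
    (i := 0) (j := 1) (k := 3) (by decide) (by decide) (by decide) hξ hx1) (hsS 3)
  obtain ⟨τ₁, hτ₁, hτ₁x⟩ := exists_map_eq_neg (notMem_of_linearIndependent hP' hli
    (i := 0) (j := 2) (k := 1) (by decide) (by decide) (by decide) hξ' hx2) (hsS' 1)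
  obtain ⟨τ₃, hτ₃, hτ₃x⟩ := exists_map_eq_neg (notMem_of_linearIndependent hP' hli
    (i := 0) (j := 2) (k := 3) (by decide) (by decide) (by decide) hξ' hx2) (hsS' 3)
  have o2 : ∀ z ∈ fixSpace S, ⟪x 2, z⟫_ℝ = 0 := fun z hz =>
    inner_eq_zero_of_map_eq_neg hσ₂x (hz _ hσ₂)
  have o3 : ∀ z ∈ fixSpace S, ⟪x 3, z⟫_ℝ = 0 := fun z hz =>
    inner_eq_zero_of_map_eq_neg hσ₃x (hz _ hσ₃)
  have o1' : ∀ z ∈ fixSpace S', ⟪x 1, z⟫_ℝ = 0 := fun z hz =>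
    inner_eq_zero_of_map_eq_neg hτ₁x (hz _ hτ₁)
  have o3' : ∀ z ∈ fixSpace S', ⟪x 3, z⟫_ℝ = 0 := fun z hz =>
    inner_eq_zero_of_map_eq_neg hτ₃x (hz _ hτ₃)
  -- The linearization need not be symmetric; orthogonality comes from isometries that reverse one
  -- eigenvector and fix the other.
  have horth : ∀ i j : Fin 4, i ≠ j → ⟪x i, x j⟫_ℝ = 0 := by
    have key : ∀ i j : Fin 4, j < i → ⟪x i, x j⟫_ℝ = 0 := by
      intro i j hij
      fin_cases i <;> fin_cases j <;> first | exact absurd hij (by decide) | skip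
      · exact o1' _ hξ'
      · exact o2 _ hξ
      · exact o2 _ hx1
      · exact o3 _ hξ
      · exact o3 _ hx1
      · exact o3' _ hx2
    intro i j hij
    rcases lt_or_gt_of_ne hij with h | h
    · rw [real_inner_comm]; exact key j i h
    · exact key i j h
  have hn : ∀ i, ‖x i‖ ≠ 0 := fun i => norm_ne_zero_iff.2 (hx i).1
  have hon : Orthonormal ℝ fun i => ‖x i‖⁻¹ • x i := by
    refine ⟨fun i => ?_, fun i j hij => ?_⟩
    · rw [norm_smul, norm_inv, norm_norm, inv_mul_cancel₀ (hn i)]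
    · simp only [inner_smul_left, inner_smul_right, horth i j hij, mul_zero]
  let b : OrthonormalBasis (Fin 4) ℝ R4 := OrthonormalBasis.mk hon (by
    have h4 : Submodule.span ℝ (Set.range fun i => ‖x i‖⁻¹ • x i) = ⊤ :=
      hon.linearIndependent.span_eq_top_of_card_eq_finrank' (by simp)
    exact h4.ge)
  have hb : ∀ i, b i = ‖x i‖⁻¹ • x i := fun i => by simp [b]
  have hbfix : ∀ (γ : O4) i, γ (x i) = x i → γ (b i) = b i := fun γ i h => by
    rw [hb, map_smul, h]
  have hbneg : ∀ (γ : O4) i, γ (x i) = -x i → γ (b i) = -b i := fun γ i h => by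
    rw [hb, map_smul, h, smul_neg]
  have hbor : ∀ (γ : O4) i, (γ (x i) = x i ∨ γ (x i) = -x i) → (γ (b i) = b i ∨ γ (b i) = -b i) :=
    fun γ i h => h.imp (hbfix γ i) (hbneg γ i)
  have hdiag : ∀ (γ : O4), γ ∈ Γ → ∀ ε : Fin 4 → ℝ, γ (b 0) = ε 0 • b 0 → γ (b 1) = ε 1 • b 1 →
      γ (b 2) = ε 2 • b 2 → γ (b 3) = ε 3 • b 3 → HasDiagonal Γ b ε := by
    intro γ hγ ε e0 e1 e2 e3
    refine ⟨γ, hγ, fun i => ?_⟩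
    fin_cases i
    exacts [e0, e1, e2, e3]
  refine ⟨b, ?_, fun y => ⟨fun hy => ?_, fun hy => ?_⟩, fun y => ⟨fun hy => ?_, fun hy => ?_⟩,
    fun γ hγ h i => hbor γ i (hsign γ hγ h i), ?_, ?_, μ, fun i => ?_, hμ1, hμ2⟩
  · rw [hb, hx0, smul_smul, mul_inv_cancel₀ (norm_ne_zero_iff.2 h0), one_smul]
  · simp [hb, inner_smul_left, o2 y hy, o3 y hy]
  · rw [b.sum_four y, hy.1, hy.2, zero_smul, zero_smul, add_zero, add_zero, hb, hb]
    exact Submodule.add_mem _ (Submodule.smul_mem _ _ (Submodule.smul_mem _ _ hξ))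
      (Submodule.smul_mem _ _ (Submodule.smul_mem _ _ hx1))
  · simp [hb, inner_smul_left, o1' y hy, o3' y hy]
  · rw [b.sum_four y, hy.1, hy.2, zero_smul, zero_smul, add_zero, add_zero, hb, hb]
    exact Submodule.add_mem _ (Submodule.smul_mem _ _ (Submodule.smul_mem _ _ hξ'))
      (Submodule.smul_mem _ _ (Submodule.smul_mem _ _ hx2))
  · have a0 : ∀ σ ∈ S, σ (b 0) = b 0 := fun σ hσ => hbfix σ 0 (hξ σ hσ)
    have a1 : ∀ σ ∈ S, σ (b 1) = b 1 := fun σ hσ => hbfix σ 1 (hx1 σ hσ)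
    -- If neither `σ₂` nor `σ₃` reverses both transverse directions, each is a reflection and their
    -- product is the half-turn.
    rcases hbor σ₂ 3 (hsS 3 σ₂ hσ₂) with h3 | h3
    · rcases hbor σ₃ 2 (hsS 2 σ₃ hσ₃) with h2 | h2
      · have d1 := hdiag σ₂ (hS hσ₂) ![1, 1, -1, 1] (by simp [a0 _ hσ₂]) (by simp [a1 _ hσ₂])
          (by simp [hbneg _ _ hσ₂x]) (by simp [h3])
        have d2 := hdiag σ₃ (hS hσ₃) ![1, 1, 1, -1] (by simp [a0 _ hσ₃]) (by simp [a1 _ hσ₃])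
          (by simp [h2]) (by simp [hbneg _ _ hσ₃x])
        convert d1.mul d2 using 1
        funext i; fin_cases i <;> simp
      · exact hdiag σ₃ (hS hσ₃) _ (by simp [a0 _ hσ₃]) (by simp [a1 _ hσ₃])
          (by simp [h2]) (by simp [hbneg _ _ hσ₃x])
    · exact hdiag σ₂ (hS hσ₂) _ (by simp [a0 _ hσ₂]) (by simp [a1 _ hσ₂])
          (by simp [hbneg _ _ hσ₂x]) (by simp [h3])
  · have a0 : ∀ σ ∈ S', σ (b 0) = b 0 := fun σ hσ => hbfix σ 0 (hξ' σ hσ)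
    have a2 : ∀ σ ∈ S', σ (b 2) = b 2 := fun σ hσ => hbfix σ 2 (hx2 σ hσ)
    rcases hbor τ₁ 3 (hsS' 3 τ₁ hτ₁) with h3 | h3
    · rcases hbor τ₃ 1 (hsS' 1 τ₃ hτ₃) with h1 | h1
      · have d1 := hdiag τ₁ (hS' hτ₁) ![1, -1, 1, 1] (by simp [a0 _ hτ₁])
          (by simp [hbneg _ _ hτ₁x]) (by simp [a2 _ hτ₁]) (by simp [h3])
        have d2 := hdiag τ₃ (hS' hτ₃) ![1, 1, 1, -1] (by simp [a0 _ hτ₃]) (by simp [h1])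
          (by simp [a2 _ hτ₃]) (by simp [hbneg _ _ hτ₃x])
        convert d1.mul d2 using 1
        funext i; fin_cases i <;> simp
      · exact hdiag τ₃ (hS' hτ₃) _ (by simp [a0 _ hτ₃]) (by simp [h1])
          (by simp [a2 _ hτ₃]) (by simp [hbneg _ _ hτ₃x])
    · exact hdiag τ₁ (hS' hτ₁) _ (by simp [a0 _ hτ₁]) (by simp [hbneg _ _ hτ₁x])
          (by simp [a2 _ hτ₁]) (by simp [h3])
  · rw [hb, map_smul, (hx i).2, smul_comm]

/-! ### Reflections in the symmetry group -/

/-- `δ` is a unit vector, and the reflection that maps `δ` to `-δ` belongs to `Γ`. -/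
def IsUnitRoot (Γ : Subgroup O4) (δ : R4) : Prop :=
  ‖δ‖ = 1 ∧ ∃ γ ∈ Γ, ∀ x, γ x = x - (2 * ⟪δ, x⟫_ℝ) • δ

theorem IsUnitRoot.inner_self {Γ : Subgroup O4} {δ : R4} (h : IsUnitRoot Γ δ) :
    ⟪δ, δ⟫_ℝ = 1 := by rw [real_inner_self_eq_norm_sq, h.1, one_pow]

theorem IsUnitRoot.ne_zero {Γ : Subgroup O4} {δ : R4} (h : IsUnitRoot Γ δ) : δ ≠ 0 := by
  rintro rfl
  simpa using h.1

theorem IsUnitRoot.neg {Γ : Subgroup O4} {δ : R4} (h : IsUnitRoot Γ δ) : IsUnitRoot Γ (-δ) := by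
  obtain ⟨h1, γ, hγ, h⟩ := h
  refine ⟨by rwa [norm_neg], γ, hγ, fun x => ?_⟩
  rw [h, inner_neg_left]
  module

theorem IsUnitRoot.map {Γ : Subgroup O4} {δ : R4} (h : IsUnitRoot Γ δ) {g : O4} (hg : g ∈ Γ) :
    IsUnitRoot Γ (g δ) := by
  obtain ⟨h1, γ, hγ, h⟩ := h
  refine ⟨by rwa [g.norm_map], g * γ * g⁻¹, Γ.mul_mem (Γ.mul_mem hg hγ) (Γ.inv_mem hg),
    fun x => ?_⟩
  have hx : g (g⁻¹ x) = x := g.apply_symm_apply x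
  rw [LinearIsometryEquiv.coe_mul, LinearIsometryEquiv.coe_mul, Function.comp_apply,
    Function.comp_apply, h, map_sub, map_smul, hx]
  congr 3
  rw [← g.inner_map_map, hx]

/-- Reflecting a root in a root gives a root. -/
theorem IsUnitRoot.reflect {Γ : Subgroup O4} {δ ε : R4} (h : IsUnitRoot Γ δ)
    (hε : IsUnitRoot Γ ε) : IsUnitRoot Γ (δ - (2 * ⟪ε, δ⟫_ℝ) • ε) := by
  obtain ⟨-, γ, hγ, hγx⟩ := hε
  rw [← hγx]
  exact h.map hγ

theorem isUnitRoot_iff_hasDiagonal {Γ : Subgroup O4} {b : OrthonormalBasis (Fin 4) ℝ R4}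
    {i : Fin 4} : IsUnitRoot Γ (b i) ↔ HasDiagonal Γ b fun k => if k = i then -1 else 1 := by
  constructor
  · rintro ⟨-, γ, hγ, h⟩
    refine ⟨γ, hγ, fun k => ?_⟩
    rw [h]
    by_cases hk : k = i
    · subst hk
      simp only [b.inner_self_one, if_true]
      module
    · simp only [b.inner_of_ne (Ne.symm hk), if_neg hk]
      module
  · rintro ⟨γ, hγ, h⟩
    refine ⟨b.orthonormal.1 i, γ, hγ, fun x => ?_⟩
    have hx : ∀ x, γ x = ∑ k, ⟪b k, x⟫_ℝ • ((if k = i then (-1 : ℝ) else 1) • b k) := fun x => by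
      conv_lhs => rw [← b.sum_repr' x]
      simp only [map_sum, map_smul, h]
    rw [hx]
    conv_rhs => rw [← b.sum_repr' x]
    have : ∀ k, ⟪b k, x⟫_ℝ • ((if k = i then (-1 : ℝ) else 1) • b k) =
        ⟪b k, x⟫_ℝ • b k - (if k = i then (2 * ⟪b k, x⟫_ℝ) • b k else 0) := fun k => by
      split_ifs <;> module
    simp only [this, Finset.sum_sub_distrib, Finset.sum_ite_eq', Finset.mem_univ, if_true]
    rw [b.sum_repr' x]

/-- The mirror of some reflection in `Γ` contains `ξ`. -/
def HasMirror (Γ : Subgroup O4) (ξ : R4) : Prop := ∃ δ, IsUnitRoot Γ δ ∧ ⟪δ, ξ⟫_ℝ = 0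

namespace IsNodeFrame

variable {f : R4 → R4} {Γ : Subgroup O4} {ξ : R4} {P P' : Submodule ℝ R4}
  {b : OrthonormalBasis (Fin 4) ℝ R4}

/-- The roots orthogonal to a node belong to its frame. -/
theorem eq_of_isUnitRoot (hb : IsNodeFrame f Γ ξ P P' b) (h0 : ξ ≠ 0) {δ : R4}
    (hδ : IsUnitRoot Γ δ) (hδξ : ⟪δ, ξ⟫_ℝ = 0) : ∃ i ≠ 0, δ = b i ∨ δ = -b i := by
  obtain ⟨i, hi⟩ : ∃ i, ⟪b i, δ⟫_ℝ ≠ 0 := by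
    by_contra hcon
    push Not at hcon
    refine hδ.ne_zero ?_
    rw [b.sum_four δ]
    simp [hcon]
  have hn := norm_ne_zero_iff.2 h0
  have hi0 : i ≠ 0 := by
    rintro rfl
    rw [hb.node_eq, inner_smul_right, mul_eq_zero, real_inner_comm] at hδξ
    exact hi (hδξ.resolve_left hn)
  refine ⟨i, hi0, ?_⟩
  obtain ⟨h1, γ, hγ, hγx⟩ := hδ
  have hs := hb.sign γ hγ (by rw [hγx, hδξ]; simp) i
  rw [hγx, real_inner_comm] at hs
  -- The reflection fixes the node, so it maps `b i` to plus or minus itself. It moves `b i`, hence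
  -- reverses it, and only multiples of `δ` are reversed.
  have key : ⟪b i, δ⟫_ℝ • δ = b i := by
    rcases hs with hs | hs
    · have : (2 * ⟪b i, δ⟫_ℝ) • δ = 0 := by linear_combination (norm := module) (-1 : ℝ) • hs
      rcases smul_eq_zero.1 this with h | h
      · exact absurd (by linarith) hi
      · rw [h, norm_zero] at h1; norm_num at h1
    · have : (2 : ℝ) • (⟪b i, δ⟫_ℝ • δ) = (2 : ℝ) • b i := by
        linear_combination (norm := module) (-1 : ℝ) • hs
      exact smul_right_injective R4 (two_ne_zero (α := ℝ)) this
  have hn := congrArg norm key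
  rw [norm_smul, h1, b.orthonormal.1, mul_one, Real.norm_eq_abs] at hn
  rcases (abs_eq zero_le_one).1 hn with h | h
  · exact Or.inl (by rw [← key, h, one_smul])
  · exact Or.inr (by rw [← key, h, neg_one_smul, neg_neg])

/-- If a node lies on a mirror then all non-radial vectors of its frame are roots. -/
theorem isUnitRoot_of_hasMirror (hb : IsNodeFrame f Γ ξ P P' b) (h0 : ξ ≠ 0)
    (h : HasMirror Γ ξ) {k : Fin 4} (hk : k ≠ 0) : IsUnitRoot Γ (b k) := by
  obtain ⟨δ, hδ, hδξ⟩ := h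
  obtain ⟨i, hi0, hi⟩ := hb.eq_of_isUnitRoot h0 hδ hδξ
  have hbi : IsUnitRoot Γ (b i) := by
    rcases hi with rfl | rfl
    · exact hδ
    · simpa using hδ.neg
  -- For `i ≠ k` one of the two half-turns or their product reverses exactly `b i` and `b k`;
  -- composed with the reflection in `b i` it gives the reflection in `b k`.
  have h1 := hb.half_turn_in
  have h2 := hb.half_turn_out
  have h3 := h1.mul h2
  rw [isUnitRoot_iff_hasDiagonal] at hbi ⊢
  have e1 := hbi.mul h1
  have e2 := hbi.mul h2
  have e3 := hbi.mul h3
  fin_cases i <;> fin_cases k <;> first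
    | exact absurd rfl hi0
    | exact absurd rfl hk
    | exact hbi
    | (convert e1 using 1; funext m; fin_cases m <;> simp; done)
    | (convert e2 using 1; funext m; fin_cases m <;> simp; done)
    | (convert e3 using 1; funext m; fin_cases m <;> simp)

theorem inner_node_of_ne (hb : IsNodeFrame f Γ ξ P P' b) {i : Fin 4} (hi : i ≠ 0) :
    ⟪b i, ξ⟫_ℝ = 0 := by
  rw [hb.node_eq, inner_smul_right, b.inner_of_ne hi, mul_zero]

theorem zero_mem_in (hb : IsNodeFrame f Γ ξ P P' b) : b 0 ∈ P :=
  (hb.mem_in _).2 ⟨b.inner_of_ne (by decide), b.inner_of_ne (by decide)⟩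

theorem one_mem_in (hb : IsNodeFrame f Γ ξ P P' b) : b 1 ∈ P :=
  (hb.mem_in _).2 ⟨b.inner_of_ne (by decide), b.inner_of_ne (by decide)⟩

theorem zero_mem_out (hb : IsNodeFrame f Γ ξ P P' b) : b 0 ∈ P' :=
  (hb.mem_out _).2 ⟨b.inner_of_ne (by decide), b.inner_of_ne (by decide)⟩

theorem two_mem_out (hb : IsNodeFrame f Γ ξ P P' b) : b 2 ∈ P' :=
  (hb.mem_out _).2 ⟨b.inner_of_ne (by decide), b.inner_of_ne (by decide)⟩

end IsNodeFrame

/-! ### Mirrors through nodes and type A -/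

namespace HeteroclinicCycle

variable {f : R4 → R4} {Γ : Subgroup O4}

theorem node_mem_carrier (X : HeteroclinicCycle f Γ) (j : ZMod X.len) : X.node j ∈ X.carrier :=
  Or.inl ⟨j, rfl⟩

theorem IsSimple.node_ne_zero {X : HeteroclinicCycle f Γ} (hX : X.IsSimple) (j : ZMod X.len) :
    X.node j ≠ 0 := fun h => hX.zero_notMem (h ▸ X.node_mem_carrier j)

theorem iso_le (X : HeteroclinicCycle f Γ) (j : ZMod X.len) : X.iso j ≤ Γ := by
  obtain ⟨x, hx⟩ := X.iso_isotropy j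
  rw [hx]
  exact fun γ hγ => hγ.1

/-- A symmetry that fixes `P_j` pointwise belongs to `Σ_j`. -/
theorem mem_iso (X : HeteroclinicCycle f Γ) (j : ZMod X.len) {γ : O4} (hγ : γ ∈ Γ)
    (h : ∀ x ∈ X.P j, γ x = x) : γ ∈ X.iso j := by
  obtain ⟨x, hx⟩ := X.iso_isotropy j
  have hxP : x ∈ X.P j := fun σ hσ => by
    rw [hx] at hσ
    exact hσ.2
  rw [hx]
  exact ⟨hγ, h x hxP⟩

theorem node_mem_P (X : HeteroclinicCycle f Γ) (j : ZMod X.len) : X.node j ∈ X.P j :=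
  (X.saddle j).1

theorem node_succ_mem_P (X : HeteroclinicCycle f Γ) (j : ZMod X.len) :
    X.node (j + 1) ∈ X.P j := (X.sink j).1

theorem IsSimple.exists_isNodeFrame {X : HeteroclinicCycle f Γ} (hX : X.IsSimple)
    (hf : ContDiff ℝ 1 f) (hΓ : IsEquivariant f Γ) (j : ZMod X.len) :
    ∃ b, IsNodeFrame f Γ (X.node j) (X.P (j - 1)) (X.P j) b := by
  have hsink := X.sink (j - 1)
  rw [sub_add_cancel] at hsink
  exact _root_.exists_isNodeFrame hf hΓ (hX.node_ne_zero j) (X.iso_le (j - 1)) (X.iso_le j)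
    (hX.finrank_P _) (hX.finrank_P _) hsink (X.saddle j) (hX.eigenvalues_nodup j)

/-- The contracting vector at a node on a mirror is a root, and it is orthogonal to the outgoing
plane, which contains the next node. -/
theorem IsSimple.hasMirror_succ {X : HeteroclinicCycle f Γ} (hX : X.IsSimple)
    (hf : ContDiff ℝ 1 f) (hΓ : IsEquivariant f Γ) (j : ZMod X.len)
    (h : HasMirror Γ (X.node j)) : HasMirror Γ (X.node (j + 1)) := by
  obtain ⟨b, hb⟩ := hX.exists_isNodeFrame hf hΓ j
  exact ⟨b 1, hb.isUnitRoot_of_hasMirror (hX.node_ne_zero j) h (by decide),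
    ((hb.mem_out _).1 (X.node_succ_mem_P j)).1⟩

/-- A simple cycle is of type A exactly if none of its nodes lies on a mirror. -/
theorem IsSimple.isTypeA_iff {X : HeteroclinicCycle f Γ} (hX : X.IsSimple)
    (hf : ContDiff ℝ 1 f) (hΓ : IsEquivariant f Γ) :
    X.IsTypeA ↔ ∀ j, ¬ HasMirror Γ (X.node j) := by
  refine forall_congr' fun j => ?_
  obtain ⟨b, hb⟩ := hX.exists_isNodeFrame hf hΓ j
  have h0 := hX.node_ne_zero j
  constructor
  · rintro ⟨φ⟩ hm
    -- A mirror through the node puts two different reflections into Σ_j, too many for a group of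
    -- order two.
    have hmem : ∀ i, (i = 1 ∨ i = 3) → ∃ γ ∈ X.iso j, ∀ x, γ x = x - (2 * ⟪b i, x⟫_ℝ) • b i := by
      intro i hi
      obtain ⟨-, γ, hγ, hγx⟩ := hb.isUnitRoot_of_hasMirror h0 hm (k := i)
        (by rcases hi with rfl | rfl <;> decide)
      refine ⟨γ, X.mem_iso j hγ fun x hx => ?_, hγx⟩
      have hx' := (hb.mem_out x).1 hx
      rw [hγx]
      rcases hi with rfl | rfl
      · simp [hx'.1]
      · simp [hx'.2]
    obtain ⟨γ₁, h₁, e₁⟩ := hmem 1 (Or.inl rfl)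
    obtain ⟨γ₃, h₃, e₃⟩ := hmem 3 (Or.inr rfl)
    have hbne : ∀ i, b i ≠ 0 := fun i => b.orthonormal.ne_zero i
    have hmove : ∀ (γ : O4) i, (∀ x, γ x = x - (2 * ⟪b i, x⟫_ℝ) • b i) → γ (b i) ≠ b i := by
      intro γ i hγ hfix
      rw [hγ, b.inner_self_one] at hfix
      have : (2 : ℝ) • b i = 0 := by linear_combination (norm := module) (-1 : ℝ) • hfix
      exact hbne i ((smul_eq_zero.1 this).resolve_left two_ne_zero)
    have hz : ∀ x y : Multiplicative (ZMod 2), x ≠ 1 → y ≠ 1 → x = y := by decide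
    have hne1 : (⟨γ₁, h₁⟩ : X.iso j) ≠ 1 := fun h =>
      hmove γ₁ 1 e₁ (by rw [show γ₁ = 1 from congrArg Subtype.val h]; rfl)
    have hne3 : (⟨γ₃, h₃⟩ : X.iso j) ≠ 1 := fun h =>
      hmove γ₃ 3 e₃ (by rw [show γ₃ = 1 from congrArg Subtype.val h]; rfl)
    have heq : γ₁ = γ₃ := congrArg Subtype.val (φ.injective
      (hz _ _ ((map_ne_one_iff φ φ.injective).2 hne1) ((map_ne_one_iff φ φ.injective).2 hne3)))
    refine hmove γ₁ 1 e₁ ?_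
    rw [heq, e₃, b.inner_of_ne (by decide)]
    simp
  · intro hm
    obtain ⟨σ, hσ, hσb⟩ := hb.half_turn_out
    have hσ0 : σ (b 0) = b 0 := by simp [hσb]
    have hσ1 : σ (b 1) = -b 1 := by simp [hσb]
    have hσ2 : σ (b 2) = b 2 := by simp [hσb]
    have hσ3 : σ (b 3) = -b 3 := by simp [hσb]
    have hσmem : σ ∈ X.iso j := X.mem_iso j hσ fun x hx => by
      have hx' := (hb.mem_out x).1 hx
      rw [b.sum_four x, hx'.1, hx'.2]
      simp [hσ0, hσ2]
    have hσne : (⟨σ, hσmem⟩ : X.iso j) ≠ 1 := fun h => by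
      have h1 : σ (b 1) = b 1 := by rw [show σ = 1 from congrArg Subtype.val h]; rfl
      rw [hσ1] at h1
      have h2 : (2 : ℝ) • b 1 = 0 := by linear_combination (norm := module) (-1 : ℝ) • h1
      exact b.orthonormal.ne_zero 1 ((smul_eq_zero.1 h2).resolve_left two_ne_zero)
    have hroot : ∀ γ ∈ Γ, ∀ i : Fin 4, i ≠ 0 →
        ¬ ∀ k, γ (b k) = (if k = i then (-1 : ℝ) else 1) • b k := fun γ hγ i hi h =>
      hm ⟨b i, isUnitRoot_iff_hasDiagonal.2 ⟨γ, hγ, h⟩, hb.inner_node_of_ne hi⟩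
    -- An element of Σ_j fixes `b 0` and `b 2` and changes the signs of `b 1` and `b 3`. Changing
    -- just one sign would be a reflection whose mirror contains the node.
    have hcard : Nat.card (X.iso j) = 2 := by
      refine Nat.card_eq_two_iff.2 ⟨1, ⟨σ, hσmem⟩, hσne.symm, Set.eq_univ_of_forall ?_⟩
      rintro ⟨γ, hγ⟩
      have g0 : γ (b 0) = b 0 := hb.zero_mem_out γ hγ
      have g2 : γ (b 2) = b 2 := hb.two_mem_out γ hγ
      have hγΓ := X.iso_le j hγ
      have hs := hb.sign γ hγΓ (X.node_mem_P j γ hγ)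
      rcases hs 1 with g1 | g1 <;> rcases hs 3 with g3 | g3
      · refine Or.inl (Subtype.ext (isometry_ext (b := b) fun i => ?_))
        fin_cases i
        exacts [g0, g1, g2, g3]
      · refine absurd (fun k => ?_) (hroot γ hγΓ 3 (by decide))
        fin_cases k <;> simp [g0, g1, g2, g3]
      · refine absurd (fun k => ?_) (hroot γ hγΓ 1 (by decide))
        fin_cases k <;> simp [g0, g1, g2, g3]
      · refine Or.inr (Subtype.ext (isometry_ext (b := b) fun i => ?_))
        fin_cases i
        exacts [g0.trans hσ0.symm, g1.trans hσ1.symm, g2.trans hσ2.symm, g3.trans hσ3.symm]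
    have : Fact (Nat.Prime 2) := ⟨Nat.prime_two⟩
    exact ⟨mulEquivOfPrimeCardEq (p := 2) hcard (by simp)⟩

theorem IsSimple.hasMirror_of_not_isTypeA {X : HeteroclinicCycle f Γ} (hX : X.IsSimple)
    (hf : ContDiff ℝ 1 f) (hΓ : IsEquivariant f Γ) (hA : ¬ X.IsTypeA) (j : ZMod X.len) :
    HasMirror Γ (X.node j) := by
  rw [hX.isTypeA_iff hf hΓ] at hA
  push Not at hA
  obtain ⟨i, hi⟩ := hA
  exact X.forall_of_succ (p := fun j => HasMirror Γ (X.node j))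
    (fun j => hX.hasMirror_succ hf hΓ j) hi j

end HeteroclinicCycle

/-! ### Three-dimensional fixed-point spaces and type B -/

/-- A hyperplane is the fixed-point space of a subgroup of `Γ` only if it is a mirror. -/
theorem exists_isUnitRoot_of_finrank_fixSpace {Γ K : Subgroup O4} (hK : K ≤ Γ)
    (h3 : Module.finrank ℝ (fixSpace K) = 3) :
    ∃ δ, IsUnitRoot Γ δ ∧ ∀ x ∈ fixSpace K, ⟪δ, x⟫_ℝ = 0 := by
  have h1 : Module.finrank ℝ (fixSpace K)ᗮ = 1 := by
    have := (fixSpace K).finrank_add_finrank_orthogonal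
    rw [h3, finrank_euclideanSpace_fin] at this
    omega
  obtain ⟨⟨v, hv⟩, hv0, hspan⟩ := finrank_eq_one_iff'.1 h1
  have hv0' : v ≠ 0 := fun h => hv0 (Subtype.ext h)
  have hvn := norm_ne_zero_iff.2 hv0'
  obtain ⟨k, hk, hkv⟩ : ∃ k ∈ K, k v ≠ v := by
    by_contra hcon
    push Not at hcon
    exact hv0' (inner_self_eq_zero.1 (hv v hcon))
  -- The orthogonal complement is a line preserved by `K`, so an element moving `v` must reverse it.
  have hkv' : k v = -v := by
    have hmem : k v ∈ (fixSpace K)ᗮ := fun x hx => by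
      rw [← hx k hk, k.inner_map_map]
      exact hv x hx
    obtain ⟨c, hc⟩ := hspan ⟨k v, hmem⟩
    have hc' : c • v = k v := congrArg Subtype.val hc
    have hn := k.norm_map v
    rw [← hc', norm_smul, Real.norm_eq_abs] at hn
    have hc1 : |c| = 1 := by
      field_simp at hn
      exact hn
    rcases (abs_eq zero_le_one).1 hc1 with h | h
    · rw [h, one_smul] at hc'
      exact absurd hc'.symm hkv
    · rw [← hc', h, neg_one_smul]
  have hvv : ⟪v, v⟫_ℝ = ‖v‖ * ‖v‖ := real_inner_self_eq_norm_mul_norm v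
  refine ⟨‖v‖⁻¹ • v, ⟨by rw [norm_smul, norm_inv, norm_norm, inv_mul_cancel₀ hvn], k, hK hk,
    fun x => ?_⟩, fun x hx => ?_⟩
  · have hw : x - (⟪v, x⟫_ℝ / (‖v‖ * ‖v‖)) • v ∈ fixSpace K := by
      rw [← Submodule.orthogonal_orthogonal (fixSpace K)]
      intro u hu
      obtain ⟨c, hc⟩ := hspan ⟨u, hu⟩
      have hc' : c • v = u := congrArg Subtype.val hc
      rw [← hc', inner_smul_left, inner_sub_right, inner_smul_right, hvv]
      field_simp
      simp
    have hkw := hw k hk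
    rw [map_sub, map_smul, hkv'] at hkw
    have : k x = x - (2 * (⟪v, x⟫_ℝ / (‖v‖ * ‖v‖))) • v := by
      linear_combination (norm := module) (1 : ℝ) • hkw
    rw [this, inner_smul_left, smul_smul]
    congr 2
    simp only [map_inv₀, conj_trivial]
    field_simp
  · rw [inner_smul_left, real_inner_comm, hv x hx, mul_zero]

/-- Every mirror is a three-dimensional fixed-point space. -/
theorem IsUnitRoot.exists_fixSpace {Γ : Subgroup O4} {δ : R4} (h : IsUnitRoot Γ δ) :
    ∃ K : Subgroup O4, K ≤ Γ ∧ Module.finrank ℝ (fixSpace K) = 3 ∧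
      ∀ x, ⟪δ, x⟫_ℝ = 0 → x ∈ fixSpace K := by
  have hδ := h.ne_zero
  obtain ⟨-, γ, hγ, hγx⟩ := h
  have hfix : ∀ x, γ x = x ↔ ⟪δ, x⟫_ℝ = 0 := fun x => by
    rw [hγx, sub_eq_self, smul_eq_zero, mul_eq_zero]
    simp [hδ]
  have hmem : ∀ x, x ∈ fixSpace (Subgroup.zpowers γ) ↔ ⟪δ, x⟫_ℝ = 0 := fun x => by
    rw [← hfix]
    refine ⟨fun hx => hx γ (Subgroup.mem_zpowers γ), fun hx => ?_⟩
    have hle : Subgroup.zpowers γ ≤ isotropy ⊤ x :=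
      (Subgroup.zpowers_le).2 ⟨Subgroup.mem_top _, hx⟩
    exact fun σ hσ => (hle hσ).2
  refine ⟨Subgroup.zpowers γ, Subgroup.zpowers_le.2 hγ, ?_, fun x hx => (hmem x).2 hx⟩
  have heq : fixSpace (Subgroup.zpowers γ) = (ℝ ∙ δ)ᗮ := by
    ext x
    rw [hmem, Submodule.mem_orthogonal_singleton_iff_inner_right]
  have : Fact (Module.finrank ℝ R4 = 3 + 1) := ⟨by simp⟩
  rw [heq, Submodule.finrank_orthogonal_span_singleton (n := 3) hδ]

namespace HeteroclinicCycle

variable {f : R4 → R4} {Γ : Subgroup O4}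

theorem isTypeB_iff {X : HeteroclinicCycle f Γ} :
    X.IsTypeB ↔ ∃ δ, IsUnitRoot Γ δ ∧ ∀ x ∈ X.carrier, ⟪δ, x⟫_ℝ = 0 := by
  constructor
  · rintro ⟨K, hK, h3, hsub⟩
    obtain ⟨δ, hδ, h⟩ := exists_isUnitRoot_of_finrank_fixSpace hK h3
    exact ⟨δ, hδ, fun x hx => h x (hsub hx)⟩
  · rintro ⟨δ, hδ, h⟩
    obtain ⟨K, hK, h3, hsub⟩ := hδ.exists_fixSpace
    exact ⟨K, hK, h3, fun x hx => hsub x (h x hx)⟩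

theorem isTypeB_of_forall_P {X : HeteroclinicCycle f Γ} {δ : R4} (hδ : IsUnitRoot Γ δ)
    (h : ∀ j, ∀ x ∈ X.P j, ⟪δ, x⟫_ℝ = 0) : X.IsTypeB := by
  refine isTypeB_iff.2 ⟨δ, hδ, ?_⟩
  rintro x (⟨j, rfl⟩ | hx)
  · exact h j _ (X.node_mem_P j)
  · obtain ⟨j, t, rfl⟩ := Set.mem_iUnion.1 hx
    exact h j _ (X.conn_mem j t)

theorem IsTypeB.hasMirror {X : HeteroclinicCycle f Γ} (hB : X.IsTypeB) (j : ZMod X.len) :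
    HasMirror Γ (X.node j) := by
  obtain ⟨δ, hδ, h⟩ := isTypeB_iff.1 hB
  exact ⟨δ, hδ, h _ (X.node_mem_carrier j)⟩

theorem IsSimple.not_isTypeB_of_isTypeA {X : HeteroclinicCycle f Γ} (hX : X.IsSimple)
    (hf : ContDiff ℝ 1 f) (hΓ : IsEquivariant f Γ) (hA : X.IsTypeA) : ¬ X.IsTypeB :=
  fun hB => (hX.isTypeA_iff hf hΓ).1 hA 0 (hB.hasMirror 0)

end HeteroclinicCycle

/-- Type A spreads over a simple network. -/
theorem IsSimpleNetwork.isTypeA_of_isTypeA {f : R4 → R4} (hf : ContDiff ℝ 1 f)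
    {Γ : Subgroup O4} (hΓ : IsEquivariant f Γ) {ι : Type*} {X : ι → HeteroclinicCycle f Γ}
    (hX : IsSimpleNetwork X) {k : ι} (hk : (X k).IsTypeA) (l : ι) : (X l).IsTypeA := by
  refine hX.forall_of_node_eq hf (p := fun k => (X k).IsTypeA) (fun k l i j hij hk => ?_) hk l
  by_contra hl
  refine ((hX.simple k).isTypeA_iff hf hΓ).1 hk i ?_
  -- A cycle not of type A would have a mirror through each of its nodes, including the shared one.
  rw [hij]
  exact (hX.simple l).hasMirror_of_not_isTypeA hf hΓ hl j

/-! ### Mirrors and connections -/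

/-- Suppose that no mirror of the finite group `Γ` separates `p` from `q`, and that the mirrors
through `p` or `q` have their normals in `P` or in `Pᗮ`. If `P` contains normals of a mirror
through `p` and of one through `q`, then all mirrors have their normals in `P` or in `Pᗮ`. -/
theorem IsUnitRoot.mem_or_mem_orthogonal {Γ : Subgroup O4} (hfin : Finite Γ)
    {P : Submodule ℝ R4} {p q e c : R4} (heP : e ∈ P) (hcP : c ∈ P) (he : IsUnitRoot Γ e)
    (hc : IsUnitRoot Γ c) (hp0 : p ≠ 0) (hep : ⟪e, p⟫_ℝ = 0) (hcq : ⟪c, q⟫_ℝ = 0)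
    (heq : 0 < ⟪e, q⟫_ℝ) {s : ℝ} (hs : 0 < s) (hcs : c = s • p + ⟪e, c⟫_ℝ • e)
    (hcross : ∀ δ, IsUnitRoot Γ δ → 0 < ⟪δ, p⟫_ℝ → 0 ≤ ⟪δ, q⟫_ℝ)
    (hp : ∀ δ, IsUnitRoot Γ δ → ⟪δ, p⟫_ℝ = 0 → δ ∈ P ∨ δ ∈ Pᗮ)
    (hq : ∀ δ, IsUnitRoot Γ δ → ⟪δ, q⟫_ℝ = 0 → δ ∈ P ∨ δ ∈ Pᗮ)
    {δ : R4} (hδ : IsUnitRoot Γ δ) : δ ∈ P ∨ δ ∈ Pᗮ := by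
  by_contra hbad
  have hcross' : ∀ δ, IsUnitRoot Γ δ → 0 < ⟪δ, q⟫_ℝ → 0 ≤ ⟪δ, p⟫_ℝ := by
    intro δ hδ h
    by_contra hlt
    have := hcross (-δ) hδ.neg (by rw [inner_neg_left]; linarith)
    rw [inner_neg_left] at this
    linarith
  have hcp : 0 < ⟪c, p⟫_ℝ := by
    rw [hcs, inner_add_left, inner_smul_left, inner_smul_left, hep, mul_zero, add_zero]
    exact mul_pos hs (real_inner_self_pos.2 hp0)
  -- The reflection of `c` in `e` is a root positive at `p`, and its value at `q` is `-2⟪e, c⟫⟪e,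
  -- q⟫`.
  have hec : ⟪e, c⟫_ℝ ≤ 0 := by
    have h := hcross _ (hc.reflect he) (by
      rw [inner_sub_left, inner_smul_left, hep, mul_zero, sub_zero]; exact hcp)
    rw [inner_sub_left, inner_smul_left, hcq, conj_trivial] at h
    by_contra hlt
    nlinarith [mul_pos (not_le.1 hlt) heq]
  -- Reflections with normal in `P` preserve the property of being off `P` and `Pᗮ`.
  have hoff : ∀ n, n ∈ P → IsUnitRoot Γ n → ∀ δ, ¬ (δ ∈ P ∨ δ ∈ Pᗮ) →
      ¬ (δ - (2 * ⟪n, δ⟫_ℝ) • n ∈ P ∨ δ - (2 * ⟪n, δ⟫_ℝ) • n ∈ Pᗮ) := by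
    rintro n hnP hn δ hδ (h | h)
    · refine hδ (Or.inl ?_)
      have := P.add_mem h (P.smul_mem (2 * ⟪n, δ⟫_ℝ) hnP)
      rwa [sub_add_cancel] at this
    · have h0 := h n hnP
      rw [inner_sub_right, inner_smul_right, hn.inner_self] at h0
      have h1 : ⟪n, δ⟫_ℝ = 0 := by linarith
      rw [h1, mul_zero, zero_smul, sub_zero] at h
      exact hδ (Or.inr h)
  have hpos : ∀ δ, IsUnitRoot Γ δ → ¬ (δ ∈ P ∨ δ ∈ Pᗮ) → 0 < ⟪δ, p⟫_ℝ → 0 < ⟪δ, q⟫_ℝ :=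
    fun δ hδ hn h => lt_of_le_of_ne (hcross δ hδ h) fun h0 => hn (hq δ hδ h0.symm)
  have hpos' : ∀ δ, IsUnitRoot Γ δ → ¬ (δ ∈ P ∨ δ ∈ Pᗮ) → 0 < ⟪δ, q⟫_ℝ → 0 < ⟪δ, p⟫_ℝ :=
    fun δ hδ hn h => lt_of_le_of_ne (hcross' δ hδ h) fun h0 => hn (hp δ hδ h0.symm)
  obtain ⟨η, hη, hηbad, hηp⟩ : ∃ η, IsUnitRoot Γ η ∧ ¬ (η ∈ P ∨ η ∈ Pᗮ) ∧ 0 < ⟪η, p⟫_ℝ := by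
    rcases lt_trichotomy ⟪δ, p⟫_ℝ 0 with h | h | h
    · refine ⟨-δ, hδ.neg, ?_, by rw [inner_neg_left]; linarith⟩
      rwa [neg_mem_iff, neg_mem_iff]
    · exact absurd (hp δ hδ h) hbad
    · exact ⟨δ, hδ, hbad, h⟩
  -- Among the images of the offending root that still offend and are positive at `p`, take one with
  -- least sum of values at `p` and `q`.
  let S : Set O4 := {γ | γ ∈ Γ ∧ ¬ (γ η ∈ P ∨ γ η ∈ Pᗮ) ∧ 0 < ⟪γ η, p⟫_ℝ}
  have hSfin : S.Finite := (Set.toFinite (Γ : Set O4)).subset fun γ hγ => hγ.1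
  obtain ⟨γ, ⟨hγ, hγbad, hγp⟩, hmin⟩ := Set.exists_min_image S
    (fun γ => ⟪γ η, p⟫_ℝ + ⟪γ η, q⟫_ℝ) hSfin ⟨1, Γ.one_mem, hηbad, hηp⟩
  have hζ := hη.map hγ
  -- Reflection in `n` lowers this sum by `2⟪n, γ η⟫(⟪n, p⟫ + ⟪n, q⟫)`, which minimality keeps
  -- nonpositive.
  have hstep : ∀ n, n ∈ P → IsUnitRoot Γ n →
      0 < ⟪γ η - (2 * ⟪n, γ η⟫_ℝ) • n, p⟫_ℝ →
      ⟪n, γ η⟫_ℝ * (⟪n, p⟫_ℝ + ⟪n, q⟫_ℝ) ≤ 0 := by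
    intro n hnP hn hnp
    have hbad' := hoff n hnP hn _ hγbad
    obtain ⟨-, g, hg, hgx⟩ := id hn
    have hgγ : (g * γ) η = γ η - (2 * ⟪n, γ η⟫_ℝ) • n := by
      rw [LinearIsometryEquiv.coe_mul, Function.comp_apply, hgx]
    have h := hmin (g * γ) ⟨Γ.mul_mem hg hγ, by rwa [hgγ], by rwa [hgγ]⟩
    simp only [hgγ, inner_sub_left, inner_smul_left, conj_trivial] at h
    linarith
  have h1 : ⟪e, γ η⟫_ℝ ≤ 0 := by
    have h := hstep e heP he (by
      rw [inner_sub_left, inner_smul_left, hep, mul_zero, sub_zero]; exact hγp)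
    rw [hep, zero_add] at h
    by_contra hlt
    nlinarith [mul_pos (not_le.1 hlt) heq]
  have h2 : ⟪c, γ η⟫_ℝ ≤ 0 := by
    have hq' : 0 < ⟪γ η - (2 * ⟪c, γ η⟫_ℝ) • c, q⟫_ℝ := by
      rw [inner_sub_left, inner_smul_left, hcq, mul_zero, sub_zero]
      exact hpos _ hζ hγbad hγp
    have h := hstep c hcP hc (hpos' _ (hζ.reflect hc) (hoff c hcP hc _ hγbad) hq')
    rw [hcq, add_zero] at h
    by_contra hlt
    nlinarith [mul_pos (not_le.1 hlt) hcp]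
  have h3 : ⟪c, γ η⟫_ℝ = s * ⟪γ η, p⟫_ℝ + ⟪e, c⟫_ℝ * ⟪e, γ η⟫_ℝ := by
    conv_lhs => rw [hcs]
    rw [inner_add_left, inner_smul_left, inner_smul_left, real_inner_comm p]
    simp
  -- In `h3` the first term is positive and the second is nonnegative, against `h2`.
  nlinarith [mul_pos hs hγp, mul_nonneg_of_nonpos_of_nonpos hec h1]

namespace IsNodeFrame

variable {f : R4 → R4} {Γ : Subgroup O4} {ξ : R4} {P P' : Submodule ℝ R4}
  {b : OrthonormalBasis (Fin 4) ℝ R4}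

theorem eq_of_mem_out (hb : IsNodeFrame f Γ ξ P P' b) {x : R4} (hx : x ∈ P') :
    x = ⟪b 0, x⟫_ℝ • b 0 + ⟪b 2, x⟫_ℝ • b 2 := by
  have h := (hb.mem_out x).1 hx
  conv_lhs => rw [b.sum_four x, h.1, h.2]
  module

theorem eq_of_mem_in (hb : IsNodeFrame f Γ ξ P P' b) {x : R4} (hx : x ∈ P) :
    x = ⟪b 0, x⟫_ℝ • b 0 + ⟪b 1, x⟫_ℝ • b 1 := by
  have h := (hb.mem_in x).1 hx
  conv_lhs => rw [b.sum_four x, h.1, h.2]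
  module

theorem mem_out_or_mem_orthogonal (hb : IsNodeFrame f Γ ξ P P' b) (h0 : ξ ≠ 0) {δ : R4}
    (hδ : IsUnitRoot Γ δ) (hδξ : ⟪δ, ξ⟫_ℝ = 0) : δ ∈ P' ∨ δ ∈ P'ᗮ := by
  have key : ∀ i ≠ 0, b i ∈ P' ∨ b i ∈ P'ᗮ := by
    intro i hi
    fin_cases i
    · exact absurd rfl hi
    · exact Or.inr ((Submodule.mem_orthogonal' _ _).2 fun x hx => ((hb.mem_out x).1 hx).1)
    · exact Or.inl hb.two_mem_out
    · exact Or.inr ((Submodule.mem_orthogonal' _ _).2 fun x hx => ((hb.mem_out x).1 hx).2)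
  obtain ⟨i, hi, rfl | rfl⟩ := hb.eq_of_isUnitRoot h0 hδ hδξ
  · exact key i hi
  · rw [neg_mem_iff, neg_mem_iff]
    exact key i hi

theorem mem_in_or_mem_orthogonal (hb : IsNodeFrame f Γ ξ P P' b) (h0 : ξ ≠ 0) {δ : R4}
    (hδ : IsUnitRoot Γ δ) (hδξ : ⟪δ, ξ⟫_ℝ = 0) : δ ∈ P ∨ δ ∈ Pᗮ := by
  have key : ∀ i ≠ 0, b i ∈ P ∨ b i ∈ Pᗮ := by
    intro i hi
    fin_cases i
    · exact absurd rfl hi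
    · exact Or.inl hb.one_mem_in
    · exact Or.inr ((Submodule.mem_orthogonal' _ _).2 fun x hx => ((hb.mem_in x).1 hx).1)
    · exact Or.inr ((Submodule.mem_orthogonal' _ _).2 fun x hx => ((hb.mem_in x).1 hx).2)
  obtain ⟨i, hi, rfl | rfl⟩ := hb.eq_of_isUnitRoot h0 hδ hδξ
  · exact key i hi
  · rw [neg_mem_iff, neg_mem_iff]
    exact key i hi

end IsNodeFrame

namespace HeteroclinicCycle

variable {f : R4 → R4} {Γ : Subgroup O4}

/-- A connection does not cross a mirror. -/
theorem inner_node_succ_nonneg (X : HeteroclinicCycle f Γ) (hf : ContDiff ℝ 1 f)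
    (hΓ : IsEquivariant f Γ) {δ : R4} (hδ : IsUnitRoot Γ δ) {j : ZMod X.len}
    (h : 0 < ⟪δ, X.node j⟫_ℝ) : 0 ≤ ⟪δ, X.node (j + 1)⟫_ℝ := by
  by_contra hlt
  rw [not_le] at hlt
  have hc : Continuous fun x : R4 => ⟪δ, x⟫_ℝ := by fun_prop
  have hbot := (hc.tendsto _).comp (X.conn_atBot j)
  have htop := (hc.tendsto _).comp (X.conn_atTop j)
  obtain ⟨a, ha⟩ := (htop.eventually (gt_mem_nhds hlt)).exists
  obtain ⟨a', ha'⟩ := (hbot.eventually (lt_mem_nhds h)).exists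
  obtain ⟨t, ht⟩ := mem_range_of_exists_le_of_exists_ge (c := 0)
    (hc.comp (X.continuous_conn j)) ⟨a, ha.le⟩ ⟨a', ha'.le⟩
  have hδ0 := hδ.ne_zero
  obtain ⟨-, γ, hγ, hγx⟩ := hδ
  have hall := map_solution_eq hf hΓ hγ (X.conn_solution j) (a := t)
    (by rw [hγx, show ⟪δ, X.conn j t⟫_ℝ = 0 from ht]; simp) a
  rw [hγx, sub_eq_self, smul_eq_zero, mul_eq_zero] at hall
  have ha0 : ⟪δ, X.conn j a⟫_ℝ < 0 := ha
  rcases hall with (h | h) | h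
  · norm_num at h
  · linarith
  · exact hδ0 h

/-- The node after `ξ_j` lies on the half-line opposite to `ξ_j`. -/
def IsAntipodalAt (X : HeteroclinicCycle f Γ) (j : ZMod X.len) : Prop :=
  ∃ κ : ℝ, 0 < κ ∧ X.node (j + 1) = -(κ • X.node j)

theorem mem_groupOrbitSet {S : Set R4} {x : R4} (hx : x ∈ S) : x ∈ groupOrbitSet Γ S :=
  ⟨1, Γ.one_mem, x, hx, rfl⟩

theorem node_mem_L (X : HeteroclinicCycle f Γ) (j : ZMod X.len) : X.node j ∈ X.L j := by
  refine ⟨?_, X.node_mem_P j⟩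
  have := X.node_succ_mem_P (j - 1)
  rwa [sub_add_cancel] at this

variable {X : HeteroclinicCycle f Γ}

/-- Symmetric copies of nodes on the half-line of `ξ_j` coincide with `ξ_j`. -/
theorem IsSimple.eq_of_smul_node (hX : X.IsSimple) {j i : ZMod X.len} {γ : O4} (hγ : γ ∈ Γ)
    {c : ℝ} (hc : 0 < c) (h : γ (X.node i) = c • X.node j) : γ (X.node i) = X.node j := by
  rw [h]
  refine (hX.meets_L j).eq_of_smul (X.node_mem_L j) (hX.node_ne_zero j)
    (mem_groupOrbitSet (X.node_mem_carrier j)) hc ?_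
  rw [← h]
  exact ⟨γ, hγ, _, X.node_mem_carrier i, rfl⟩

/-- A positive factor is excluded because the cycle meets each half-line of L_j at most once. -/
theorem IsSimple.isAntipodalAt_of_smul (hX : X.IsSimple) {j : ZMod X.len} {z : ℝ}
    (h : X.node (j + 1) = z • X.node j) : X.IsAntipodalAt j := by
  rcases lt_trichotomy z 0 with hz | hz | hz
  · exact ⟨-z, by linarith, by rw [h]; module⟩
  · rw [hz, zero_smul] at h
    exact absurd h (hX.node_ne_zero _)
  · exact absurd (hX.eq_of_smul_node Γ.one_mem hz h) (X.node_succ_ne j)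

theorem IsSimple.isAntipodalAt_of_inner_eq_zero (hX : X.IsSimple) {j : ZMod X.len}
    {P : Submodule ℝ R4} {b : OrthonormalBasis (Fin 4) ℝ R4}
    (hb : IsNodeFrame f Γ (X.node j) P (X.P j) b) (h : ⟪b 2, X.node (j + 1)⟫_ℝ = 0) :
    X.IsAntipodalAt j := by
  have hn : 0 < ‖X.node j‖ := norm_pos_iff.2 (hX.node_ne_zero _)
  have hq := hb.eq_of_mem_out (X.node_succ_mem_P j)
  rw [h, zero_smul, add_zero] at hq
  refine hX.isAntipodalAt_of_smul (z := ⟪b 0, X.node (j + 1)⟫_ℝ / ‖X.node j‖) ?_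
  conv_lhs => rw [hq]
  conv_rhs => rw [hb.node_eq]
  rw [smul_smul, norm_smul, norm_norm, b.orthonormal.1, mul_one, div_mul_cancel₀ _ hn.ne']

/-- The general statement on roots applies to consecutive nodes: `e` is the expanding vector at the
first and `c` the contracting vector at the second, with suitable signs. -/
theorem IsSimple.mem_or_mem_orthogonal_of_not_isAntipodalAt (hX : X.IsSimple)
    (hf : ContDiff ℝ 1 f) (hfin : Finite Γ) (hΓ : IsEquivariant f Γ)
    (hA : ¬ X.IsTypeA) {j : ZMod X.len} (hj : ¬ X.IsAntipodalAt j) {δ : R4}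
    (hδ : IsUnitRoot Γ δ) : δ ∈ X.P j ∨ δ ∈ (X.P j)ᗮ := by
  obtain ⟨b, hb⟩ := hX.exists_isNodeFrame hf hΓ j
  obtain ⟨b', hb'⟩ := hX.exists_isNodeFrame hf hΓ (j + 1)
  rw [add_sub_cancel_right] at hb'
  have h0 := hX.node_ne_zero j
  have h0' := hX.node_ne_zero (j + 1)
  have hm := hX.hasMirror_of_not_isTypeA hf hΓ hA
  have hn : 0 < ‖X.node j‖ := norm_pos_iff.2 h0
  have hB : ⟪b 2, X.node (j + 1)⟫_ℝ ≠ 0 := fun hB =>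
    hj (hX.isAntipodalAt_of_inner_eq_zero hb hB)
  have hc1 := hb.eq_of_mem_out hb'.one_mem_in
  have hc1q : ⟪b' 1, X.node (j + 1)⟫_ℝ = 0 := hb'.inner_node_of_ne (by decide)
  -- Otherwise `b' 1` would be a multiple of `b 2`; being orthogonal to the second node, which `b 2`
  -- is not, it would vanish.
  have hx : ⟪b 0, b' 1⟫_ℝ ≠ 0 := by
    intro hx
    rw [hx, zero_smul, zero_add] at hc1
    rw [hc1, inner_smul_left, mul_eq_zero] at hc1q
    have : ⟪b 2, b' 1⟫_ℝ = 0 := by simpa [hB] using hc1q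
    rw [this, zero_smul] at hc1
    exact b'.orthonormal.ne_zero 1 hc1
  obtain ⟨e, heP, he, hep, heq, heb⟩ : ∃ e ∈ X.P j, IsUnitRoot Γ e ∧ ⟪e, X.node j⟫_ℝ = 0 ∧
      0 < ⟪e, X.node (j + 1)⟫_ℝ ∧ (e = b 2 ∨ e = -b 2) := by
    have hr := hb.isUnitRoot_of_hasMirror h0 (hm j) (k := 2) (by decide)
    have ho := hb.inner_node_of_ne (i := 2) (by decide)
    rcases lt_or_gt_of_ne hB with h | h
    · refine ⟨-b 2, neg_mem hb.two_mem_out, hr.neg, ?_, ?_, Or.inr rfl⟩ <;>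
        rw [inner_neg_left] <;> linarith
    · exact ⟨b 2, hb.two_mem_out, hr, ho, h, Or.inl rfl⟩
  obtain ⟨c, hcP, hc, hcq, hcb⟩ : ∃ c ∈ X.P j, IsUnitRoot Γ c ∧ ⟪c, X.node (j + 1)⟫_ℝ = 0 ∧
      0 < ⟪b 0, c⟫_ℝ := by
    have hr := hb'.isUnitRoot_of_hasMirror h0' (hm (j + 1)) (k := 1) (by decide)
    rcases lt_or_gt_of_ne hx with h | h
    · refine ⟨-b' 1, neg_mem hb'.one_mem_in, hr.neg, ?_, ?_⟩
      · rw [inner_neg_left, hc1q, neg_zero]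
      · rw [inner_neg_right]; linarith
    · exact ⟨b' 1, hb'.one_mem_in, hr, hc1q, h⟩
  have hcs : c = (⟪b 0, c⟫_ℝ / ‖X.node j‖) • X.node j + ⟪e, c⟫_ℝ • e := by
    conv_lhs => rw [hb.eq_of_mem_out hcP]
    congr 1
    · conv_rhs => rw [hb.node_eq]
      rw [smul_smul, norm_smul, norm_norm, b.orthonormal.1, mul_one, div_mul_cancel₀ _ hn.ne']
    · rcases heb with rfl | rfl
      · rfl
      · rw [inner_neg_left]; module
  exact IsUnitRoot.mem_or_mem_orthogonal hfin heP hcP he hc h0 hep hcq heq (div_pos hcb hn) hcs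
    (fun δ hδ h => X.inner_node_succ_nonneg hf hΓ hδ h)
    (fun δ hδ h => hb.mem_out_or_mem_orthogonal h0 hδ h)
    (fun δ hδ h => hb'.mem_in_or_mem_orthogonal h0' hδ h) hδ

/-- If `ξ_{j+1}` is not antipodal to `ξ_j` then it is orthogonal to the node after it, and its
direction is a root. -/
theorem IsSimple.orthogonal_succ_of_not_isAntipodalAt (hX : X.IsSimple)
    (hf : ContDiff ℝ 1 f) (hfin : Finite Γ) (hΓ : IsEquivariant f Γ)
    (hA : ¬ X.IsTypeA) {j : ZMod X.len} (hj : ¬ X.IsAntipodalAt j)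
    {b : OrthonormalBasis (Fin 4) ℝ R4}
    (hb : IsNodeFrame f Γ (X.node (j + 1)) (X.P j) (X.P (j + 1)) b) :
    IsUnitRoot Γ (b 0) ∧ ⟪b 0, X.node (j + 1 + 1)⟫_ℝ = 0 := by
  obtain ⟨a, ha⟩ := hX.exists_isNodeFrame hf hΓ j
  obtain ⟨d, hd⟩ := hX.exists_isNodeFrame hf hΓ (j + 1 + 1)
  rw [add_sub_cancel_right] at hd
  have hm := hX.hasMirror_of_not_isTypeA hf hΓ hA
  have hroot := hd.isUnitRoot_of_hasMirror (hX.node_ne_zero _) (hm _) (k := 1) (by decide)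
  have hdn : ⟪d 1, X.node (j + 1 + 1)⟫_ℝ = 0 := hd.inner_node_of_ne (by decide)
  have hd1 := hb.eq_of_mem_out hd.one_mem_in
  have hscal : ∀ (i : Fin 4), d 1 = ⟪b i, d 1⟫_ℝ • b i → IsUnitRoot Γ (b i) ∧
      ⟪b i, X.node (j + 1 + 1)⟫_ℝ = 0 := by
    intro i hi
    have hn := congrArg norm hi
    rw [norm_smul, d.orthonormal.1, b.orthonormal.1, mul_one, Real.norm_eq_abs] at hn
    have hor : b i = d 1 ∨ b i = -d 1 := by
      rcases (abs_eq zero_le_one).1 hn.symm with h | h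
      · rw [h, one_smul] at hi
        exact Or.inl hi.symm
      · rw [h, neg_one_smul] at hi
        exact Or.inr (by rw [hi, neg_neg])
    rcases hor with h | h
    · rw [h]; exact ⟨hroot, hdn⟩
    · rw [h, inner_neg_left, hdn, neg_zero]; exact ⟨hroot.neg, rfl⟩
  -- The contracting vector `d 1` two nodes further on is a root in P_{j+1}. If it lies in P_j it is
  -- `b 0` up to sign; if it is orthogonal to P_j it is `b 2` up to sign, which has to be excluded.
  rcases hX.mem_or_mem_orthogonal_of_not_isAntipodalAt hf hfin hΓ hA hj hroot with h | h
  · refine hscal 0 ?_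
    rw [((hb.mem_in _).1 h).1, zero_smul, add_zero] at hd1
    exact hd1
  · exfalso
    rw [h (b 0) hb.zero_mem_in, zero_smul, zero_add] at hd1
    have h2 := (hscal 2 hd1).2
    obtain ⟨κ, hκ, hκn⟩ := hX.isAntipodalAt_of_inner_eq_zero hb h2
    have hra := ha.isUnitRoot_of_hasMirror (hX.node_ne_zero _) (hm _) (k := 2) (by decide)
    -- Now the next two nodes are opposite, so any mirror missing the first of them would separate
    -- them. The mirror of the expanding root `a 2` therefore contains that node, making the
    -- preceding connection antipodal too.
    have hsep : ∀ δ, IsUnitRoot Γ δ → ¬ 0 < ⟪δ, X.node (j + 1)⟫_ℝ := by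
      intro δ hδ hpos
      have h := X.inner_node_succ_nonneg hf hΓ hδ hpos
      rw [hκn, inner_neg_right, inner_smul_right] at h
      nlinarith [mul_pos hκ hpos]
    have hzero : ⟪a 2, X.node (j + 1)⟫_ℝ = 0 := by
      have h1 := hsep _ hra
      have h2 := hsep _ hra.neg
      rw [inner_neg_left] at h2
      linarith
    exact hj (hX.isAntipodalAt_of_inner_eq_zero ha hzero)

/-- After a non-antipodal step the next two nodes are orthogonal, so the failure of antipodality
propagates around the cycle. -/
theorem IsSimple.not_isAntipodalAt_succ (hX : X.IsSimple)
    (hf : ContDiff ℝ 1 f) (hfin : Finite Γ) (hΓ : IsEquivariant f Γ)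
    (hA : ¬ X.IsTypeA) {j : ZMod X.len} (hj : ¬ X.IsAntipodalAt j) :
    ¬ X.IsAntipodalAt (j + 1) := by
  obtain ⟨b, hb⟩ := hX.exists_isNodeFrame hf hΓ (j + 1)
  rw [add_sub_cancel_right] at hb
  have h := (hX.orthogonal_succ_of_not_isAntipodalAt hf hfin hΓ hA hj hb).2
  rintro ⟨κ, hκ, hκn⟩
  rw [hκn, hb.node_eq, inner_neg_right, inner_smul_right, inner_smul_right,
    b.inner_self_one] at h
  have hn : 0 < ‖X.node (j + 1)‖ := norm_pos_iff.2 (hX.node_ne_zero _)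
  nlinarith [mul_pos hκ hn]

theorem IsSimple.forall_isAntipodalAt_or (hX : X.IsSimple)
    (hf : ContDiff ℝ 1 f) (hfin : Finite Γ) (hΓ : IsEquivariant f Γ) (hA : ¬ X.IsTypeA) :
    (∀ j, X.IsAntipodalAt j) ∨ ∀ j, ¬ X.IsAntipodalAt j := by
  by_cases h : ∀ j, X.IsAntipodalAt j
  · exact Or.inl h
  · push Not at h
    obtain ⟨i, hi⟩ := h
    exact Or.inr fun j => X.forall_of_succ (p := fun j => ¬ X.IsAntipodalAt j)
      (fun j hj => hX.not_isAntipodalAt_succ hf hfin hΓ hA hj) hi j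

end HeteroclinicCycle

theorem groupOrbit_eq_iff {Γ : Subgroup O4} {x y : R4} :
    groupOrbit Γ x = groupOrbit Γ y ↔ ∃ γ ∈ Γ, γ x = y := by
  constructor
  · intro h
    have hy : y ∈ groupOrbit Γ x := h ▸ ⟨1, Γ.one_mem, rfl⟩
    obtain ⟨γ, hγ, h⟩ := hy
    exact ⟨γ, hγ, h.symm⟩
  · rintro ⟨γ, hγ, rfl⟩
    ext z
    constructor
    · rintro ⟨g, hg, rfl⟩
      refine ⟨g * γ⁻¹, Γ.mul_mem hg (Γ.inv_mem hγ), ?_⟩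
      rw [LinearIsometryEquiv.coe_mul, Function.comp_apply]
      exact congrArg g (γ.symm_apply_apply x).symm
    · rintro ⟨g, hg, rfl⟩
      exact ⟨g * γ, Γ.mul_mem hg hγ, rfl⟩

theorem mem_groupOrbit_of_eq {Γ : Subgroup O4} {x y : R4} (h : groupOrbit Γ x = groupOrbit Γ y) :
    x ∈ groupOrbit Γ y := h ▸ ⟨1, Γ.one_mem, rfl⟩

theorem ncard_range_congr {α β γ : Type*} {g : α → β} {h : α → γ}
    (H : ∀ i j, g i = g j ↔ h i = h j) : (Set.range g).ncard = (Set.range h).ncard := by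
  have hk : Setoid.ker g = Setoid.ker h := Setoid.ext fun i j => H i j
  rw [← Nat.card_coe_set_eq, ← Nat.card_coe_set_eq,
    ← Nat.card_congr (Setoid.quotientKerEquivRange g),
    ← Nat.card_congr (Setoid.quotientKerEquivRange h), hk]

namespace HeteroclinicCycle

variable {f : R4 → R4} {Γ : Subgroup O4} {X : HeteroclinicCycle f Γ}

/-! ### Cycles with all nodes on one line -/

theorem IsSimple.add_two_of_isAntipodalAt (hX : X.IsSimple) (h : ∀ j, X.IsAntipodalAt j)
    (j : ZMod X.len) : j + 1 + 1 = j := by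
  obtain ⟨κ, hκ, h1⟩ := h j
  obtain ⟨κ', hκ', h2⟩ := h (j + 1)
  refine X.node_injective (hX.eq_of_smul_node Γ.one_mem (mul_pos hκ' hκ) ?_)
  change X.node (j + 1 + 1) = _
  rw [h2, h1]
  module

theorem IsSimple.eq_zero_or_one_of_isAntipodalAt (hX : X.IsSimple) (h : ∀ j, X.IsAntipodalAt j)
    (j : ZMod X.len) : j = 0 ∨ j = 1 := by
  refine X.forall_of_succ (p := fun j => j = 0 ∨ j = 1) (i := 0) (fun j hj => ?_) (Or.inl rfl) j
  rcases hj with rfl | rfl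
  · exact Or.inr (zero_add 1)
  · refine Or.inl ?_
    have := hX.add_two_of_isAntipodalAt h 0
    rwa [zero_add] at this

theorem IsSimple.node_one_notMem_of_isAntipodalAt (hX : X.IsSimple)
    (h : ∀ j, X.IsAntipodalAt j) : X.node 1 ∉ groupOrbit Γ (X.node 0) := by
  intro h1
  refine X.not_homoclinic fun j => ?_
  rcases hX.eq_zero_or_one_of_isAntipodalAt h j with rfl | rfl
  · exact ⟨1, Γ.one_mem, rfl⟩
  · exact h1

/-- With only two nodes, the incoming and outgoing planes at one of them are all the planes, and the
transverse root `b 3` is orthogonal to both. -/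
theorem IsSimple.isTypeB_of_isAntipodalAt (hX : X.IsSimple) (hf : ContDiff ℝ 1 f)
    (hΓ : IsEquivariant f Γ) (hA : ¬ X.IsTypeA) (h : ∀ j, X.IsAntipodalAt j) : X.IsTypeB := by
  obtain ⟨b, hb⟩ := hX.exists_isNodeFrame hf hΓ 0
  have hroot := hb.isUnitRoot_of_hasMirror (hX.node_ne_zero 0)
    (hX.hasMirror_of_not_isTypeA hf hΓ hA 0) (k := 3) (by decide)
  have h1 : (0 - 1 : ZMod X.len) = 1 := by
    rw [sub_eq_iff_eq_add]
    have := hX.add_two_of_isAntipodalAt h 0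
    rw [zero_add] at this
    exact this.symm
  rw [h1] at hb
  refine isTypeB_of_forall_P hroot fun j x hx => ?_
  rcases hX.eq_zero_or_one_of_isAntipodalAt h j with rfl | rfl
  · exact ((hb.mem_out x).1 hx).2
  · exact ((hb.mem_in x).1 hx).2

theorem IsSimple.numEquilibria_of_isAntipodalAt (hX : X.IsSimple)
    (h : ∀ j, X.IsAntipodalAt j) : X.numEquilibria = 2 := by
  have hrange : (Set.range fun j => groupOrbit Γ (X.node j)) =
      {groupOrbit Γ (X.node 0), groupOrbit Γ (X.node 1)} := by
    ext S
    constructor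
    · rintro ⟨j, rfl⟩
      rcases hX.eq_zero_or_one_of_isAntipodalAt h j with rfl | rfl
      · exact Or.inl rfl
      · exact Or.inr rfl
    · rintro (rfl | rfl)
      · exact ⟨0, rfl⟩
      · exact ⟨1, rfl⟩
  rw [numEquilibria, hrange]
  exact Set.ncard_pair fun he =>
    hX.node_one_notMem_of_isAntipodalAt h (mem_groupOrbit_of_eq he.symm)

/-- Otherwise -Id would identify the two nodes and the cycle would be homoclinic. -/
theorem IsSimple.neg_notMem_of_isAntipodalAt (hX : X.IsSimple) (h : ∀ j, X.IsAntipodalAt j) :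
    (LinearIsometryEquiv.neg ℝ : O4) ∉ Γ := by
  intro hneg
  obtain ⟨κ, hκ, h1⟩ := h 0
  rw [zero_add] at h1
  refine hX.node_one_notMem_of_isAntipodalAt h ⟨_, hneg, ?_⟩
  refine (hX.eq_of_smul_node hneg (inv_pos.2 hκ) ?_).symm
  rw [h1, smul_neg, smul_smul, inv_mul_cancel₀ hκ.ne', one_smul]
  rfl

end HeteroclinicCycle

/-! ### Groups whose roots form an orthonormal frame -/

/-- Up to sign, the roots of `Γ` are the vectors of the frame `w`. -/
structure IsRootFrame (Γ : Subgroup O4) (w : OrthonormalBasis (Fin 4) ℝ R4) : Prop where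
  isUnitRoot : ∀ i, IsUnitRoot Γ (w i)
  eq_of_isUnitRoot : ∀ δ, IsUnitRoot Γ δ → ∃ i, δ = w i ∨ δ = -w i

/-- Some symmetry maps the `i`-th axis of the frame `w` to the `k`-th axis. -/
def AxesRelated (Γ : Subgroup O4) (w : OrthonormalBasis (Fin 4) ℝ R4) (i k : Fin 4) : Prop :=
  ∃ γ ∈ Γ, γ (w i) = w k ∨ γ (w i) = -w k

theorem AxesRelated.symm {Γ : Subgroup O4} {w : OrthonormalBasis (Fin 4) ℝ R4} {i k : Fin 4}
    (h : AxesRelated Γ w i k) : AxesRelated Γ w k i := by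
  obtain ⟨γ, hγ, h⟩ := h
  have hinv : γ⁻¹ (γ (w i)) = w i := γ.symm_apply_apply _
  refine ⟨γ⁻¹, Γ.inv_mem hγ, ?_⟩
  rcases h with h | h
  · exact Or.inl (by rw [← h, hinv])
  · refine Or.inr ?_
    rw [h, map_neg] at hinv
    rw [← hinv, neg_neg]

theorem AxesRelated.trans {Γ : Subgroup O4} {w : OrthonormalBasis (Fin 4) ℝ R4} {i k l : Fin 4}
    (h : AxesRelated Γ w i k) (h' : AxesRelated Γ w k l) : AxesRelated Γ w i l := by
  obtain ⟨γ, hγ, h⟩ := h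
  obtain ⟨γ', hγ', h'⟩ := h'
  refine ⟨γ' * γ, Γ.mul_mem hγ' hγ, ?_⟩
  rw [LinearIsometryEquiv.coe_mul, Function.comp_apply]
  rcases h with h | h <;> rcases h' with h' | h' <;> simp [h, h']

namespace OrthonormalBasis

variable (w : OrthonormalBasis (Fin 4) ℝ R4)

theorem eq_of_inner_smul_ne_zero {i k : Fin 4} {r s : ℝ} (h : ⟪r • w i, s • w k⟫_ℝ ≠ 0) :
    i = k := by
  by_contra hik
  rw [inner_smul_left, inner_smul_right, w.inner_of_ne hik] at h
  simp at h

theorem eq_of_eq_or_eq_neg {i k : Fin 4} (h : w i = w k ∨ w i = -w k) : i = k := by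
  by_contra hik
  have h0 := w.inner_of_ne hik
  rcases h with h | h
  · rw [h, w.inner_self_one] at h0; norm_num at h0
  · rw [h, inner_neg_left, w.inner_self_one] at h0; norm_num at h0

end OrthonormalBasis

theorem eq_or_eq_neg_trans {x y z : R4} (h : x = y ∨ x = -y) (h' : y = z ∨ y = -z) :
    x = z ∨ x = -z := by
  rcases h with rfl | rfl <;> rcases h' with rfl | rfl <;> simp

theorem eq_or_eq_neg_symm {x y : R4} (h : x = y ∨ x = -y) : y = x ∨ y = -x := by
  rcases h with rfl | rfl <;> simp

namespace IsRootFrame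

variable {Γ : Subgroup O4} {w : OrthonormalBasis (Fin 4) ℝ R4}

theorem neg_mem (hw : IsRootFrame Γ w) : (LinearIsometryEquiv.neg ℝ : O4) ∈ Γ := by
  have h := fun i => isUnitRoot_iff_hasDiagonal.1 (hw.isUnitRoot i)
  obtain ⟨γ, hγ, h⟩ := ((h 0).mul (h 1)).mul ((h 2).mul (h 3))
  have : γ = LinearIsometryEquiv.neg ℝ := isometry_ext (b := w) fun i => by
    rw [h]
    fin_cases i <;> simp
  exact this ▸ hγ

/-- The symmetries permute the axes of the frame. -/
theorem exists_axis_map (hw : IsRootFrame Γ w) {γ : O4} (hγ : γ ∈ Γ) :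
    ∃ τ : Fin 4 → Fin 4, Function.Injective τ ∧ ∀ i, γ (w i) = w (τ i) ∨ γ (w i) = -w (τ i) := by
  choose τ hτ using fun i => hw.eq_of_isUnitRoot _ ((hw.isUnitRoot i).map hγ)
  refine ⟨τ, fun i k hik => ?_, hτ⟩
  have h : γ (w i) = γ (w k) ∨ γ (w i) = -γ (w k) :=
    eq_or_eq_neg_trans (hτ i) (eq_or_eq_neg_symm (hik ▸ hτ k))
  refine w.eq_of_eq_or_eq_neg (h.imp (fun h => γ.injective h) fun h => γ.injective ?_)
  rw [h, map_neg]

theorem axesRelated_iff (hw : IsRootFrame Γ w) {i k : Fin 4} :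
    AxesRelated Γ w i k ↔ groupOrbit Γ (w i) = groupOrbit Γ (w k) := by
  rw [groupOrbit_eq_iff]
  constructor
  · rintro ⟨γ, hγ, h | h⟩
    · exact ⟨γ, hγ, h⟩
    · refine ⟨LinearIsometryEquiv.neg ℝ * γ, Γ.mul_mem hw.neg_mem hγ, ?_⟩
      rw [LinearIsometryEquiv.coe_mul, Function.comp_apply, h]
      exact neg_neg _
  · rintro ⟨γ, hγ, h⟩
    exact ⟨γ, hγ, Or.inl h⟩

end IsRootFrame

/-! ### Cycles with all nodes on coordinate axes -/

/-- The node `ξ_j` lies on the axis `a j` of the frame `w`, and the connections follow the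
coordinate planes of `w`. -/
structure IsAxisMap {f : R4 → R4} {Γ : Subgroup O4} (X : HeteroclinicCycle f Γ)
    (w : OrthonormalBasis (Fin 4) ℝ R4) (a : ZMod X.len → Fin 4) : Prop where
  node_eq : ∀ j, ∃ ρ : ℝ, ρ ≠ 0 ∧ X.node j = ρ • w (a j)
  inner_P : ∀ j, ∀ x ∈ X.P j, ∀ i, i ≠ a j → i ≠ a (j + 1) → ⟪w i, x⟫_ℝ = 0
  ne_succ : ∀ j, a j ≠ a (j + 1)
  ne_succ_succ : ∀ j, a j ≠ a (j + 1 + 1)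
  expanding : ∀ j, ∃ ν : ℝ, 0 < ν ∧
    linearization f (X.node j) (w (a (j + 1))) = ν • w (a (j + 1))
  contracting : ∀ j, ∃ ν : ℝ, ν < 0 ∧
    linearization f (X.node (j + 1)) (w (a j)) = ν • w (a j)
  sign : ∀ j, ∀ γ ∈ Γ, γ (X.node j) = X.node j → ∀ i, γ (w i) = w i ∨ γ (w i) = -w i

namespace HeteroclinicCycle

variable {f : R4 → R4} {Γ : Subgroup O4} {X : HeteroclinicCycle f Γ}

theorem IsSimple.isUnitRoot_frame (hX : X.IsSimple) (hf : ContDiff ℝ 1 f) (hfin : Finite Γ)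
    (hΓ : IsEquivariant f Γ) (hA : ¬ X.IsTypeA) (h : ∀ j, ¬ X.IsAntipodalAt j) {j : ZMod X.len}
    {b : OrthonormalBasis (Fin 4) ℝ R4}
    (hb : IsNodeFrame f Γ (X.node j) (X.P (j - 1)) (X.P j) b) :
    (∀ i, IsUnitRoot Γ (b i)) ∧ ⟪b 0, X.node (j + 1)⟫_ℝ = 0 := by
  obtain ⟨i, rfl⟩ : ∃ i, i + 1 = j := ⟨j - 1, sub_add_cancel j 1⟩
  have hb' := hb
  rw [add_sub_cancel_right] at hb'
  have h0 := hX.orthogonal_succ_of_not_isAntipodalAt hf hfin hΓ hA (h i) hb'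
  refine ⟨fun k => ?_, h0.2⟩
  by_cases hk : k = 0
  · rw [hk]; exact h0.1
  · exact hb.isUnitRoot_of_hasMirror (hX.node_ne_zero _)
      (hX.hasMirror_of_not_isTypeA hf hΓ hA _) hk

theorem IsSimple.exists_isRootFrame (hX : X.IsSimple) (hf : ContDiff ℝ 1 f) (hfin : Finite Γ)
    (hΓ : IsEquivariant f Γ) (hA : ¬ X.IsTypeA) (h : ∀ j, ¬ X.IsAntipodalAt j) :
    ∃ w, IsRootFrame Γ w := by
  obtain ⟨b, hb⟩ := hX.exists_isNodeFrame hf hΓ 0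
  refine ⟨b, (hX.isUnitRoot_frame hf hfin hΓ hA h hb).1, fun δ hδ => ?_⟩
  have hin := hX.mem_or_mem_orthogonal_of_not_isAntipodalAt hf hfin hΓ hA (h (0 - 1)) hδ
  have hout := hX.mem_or_mem_orthogonal_of_not_isAntipodalAt hf hfin hΓ hA (h 0) hδ
  have hsum := b.sum_four δ
  have hscal : ∀ i, δ = ⟪b i, δ⟫_ℝ • b i → ∃ i, δ = b i ∨ δ = -b i := by
    intro i hi
    have hn := congrArg norm hi
    rw [norm_smul, hδ.1, b.orthonormal.1, mul_one, Real.norm_eq_abs] at hn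
    refine ⟨i, ?_⟩
    rcases (abs_eq zero_le_one).1 hn.symm with h | h
    · exact Or.inl (by rwa [h, one_smul] at hi)
    · exact Or.inr (by rwa [h, neg_one_smul] at hi)
  -- The incoming and outgoing planes and their complements intersect pairwise in the four lines of
  -- the frame.
  rcases hin with hin | hin <;> rcases hout with hout | hout
  · obtain ⟨h2, h3⟩ := (hb.mem_in δ).1 hin
    obtain ⟨h1, -⟩ := (hb.mem_out δ).1 hout
    exact hscal 0 (by rw [h1, h2, h3] at hsum; simpa using hsum)
  · obtain ⟨h2, h3⟩ := (hb.mem_in δ).1 hin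
    have h0 := hout _ hb.zero_mem_out
    exact hscal 1 (by rw [h0, h2, h3] at hsum; simpa using hsum)
  · obtain ⟨h1, h3⟩ := (hb.mem_out δ).1 hout
    have h0 := hin _ hb.zero_mem_in
    exact hscal 2 (by rw [h0, h1, h3] at hsum; simpa using hsum)
  · have h0 := hin _ hb.zero_mem_in
    have h1 := hin _ hb.one_mem_in
    have h2 := hout _ hb.two_mem_out
    exact hscal 3 (by rw [h0, h1, h2] at hsum; simpa using hsum)

/-- All node frames agree with `w` up to order and sign. As consecutive nodes are orthogonal, the
expanding axis at a node is the axis of the next node and the contracting axis that of the previous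
one. -/
theorem IsSimple.exists_isAxisMap (hX : X.IsSimple) (hf : ContDiff ℝ 1 f) (hfin : Finite Γ)
    (hΓ : IsEquivariant f Γ) (hA : ¬ X.IsTypeA) (h : ∀ j, ¬ X.IsAntipodalAt j)
    {w : OrthonormalBasis (Fin 4) ℝ R4} (hw : IsRootFrame Γ w) : ∃ a, IsAxisMap X w a := by
  choose b hb using hX.exists_isNodeFrame hf hΓ
  have hroot := fun j => (hX.isUnitRoot_frame hf hfin hΓ hA h (hb j)).1
  have horth := fun j => (hX.isUnitRoot_frame hf hfin hΓ hA h (hb j)).2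
  choose s hs using fun j i => hw.eq_of_isUnitRoot _ (hroot j i)
  have hs' : ∀ j i, ∃ r : ℝ, r ≠ 0 ∧ b j i = r • w (s j i) := fun j i => by
    rcases hs j i with h | h
    · exact ⟨1, one_ne_zero, by rw [h, one_smul]⟩
    · exact ⟨-1, by norm_num, by rw [h, neg_one_smul]⟩
  have hinj : ∀ j, Function.Injective (s j) := fun j i k hik =>
    (b j).eq_of_eq_or_eq_neg (eq_or_eq_neg_trans (hs j i) (eq_or_eq_neg_symm (hik ▸ hs j k)))
  have hsurj : ∀ j, Function.Surjective (s j) := fun j => Finite.surjective_of_injective (hinj j)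
  have hframe : ∀ {j j' : ZMod X.len} {i k : Fin 4}, ⟪b j i, b j' k⟫_ℝ ≠ 0 →
      s j i = s j' k := by
    intro j j' i k hne
    obtain ⟨r, -, hr⟩ := hs' j i
    obtain ⟨r', -, hr'⟩ := hs' j' k
    rw [hr, hr'] at hne
    exact w.eq_of_inner_smul_ne_zero hne
  have hnode : ∀ j, X.node j ≠ 0 := hX.node_ne_zero
  have hnn : ∀ j, ‖X.node j‖ ≠ 0 := fun j => norm_ne_zero_iff.2 (hnode j)
  have horth' : ∀ j, ⟪b j 0, b (j + 1) 0⟫_ℝ = 0 := fun j => by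
    have h := horth j
    rw [(hb (j + 1)).node_eq, inner_smul_right, mul_eq_zero] at h
    exact h.resolve_left (hnn _)
  have hb' : ∀ j, IsNodeFrame f Γ (X.node (j + 1)) (X.P j) (X.P (j + 1)) (b (j + 1)) := fun j => by
    have := hb (j + 1)
    rwa [add_sub_cancel_right] at this
  have hexp : ∀ j, s j 2 = s (j + 1) 0 := fun j => hframe fun h0 => by
    have h := (hb j).eq_of_mem_out (hb' j).zero_mem_in
    rw [horth', h0, zero_smul, zero_smul, add_zero] at h
    exact (b (j + 1)).orthonormal.ne_zero 0 h
  have hcon : ∀ j, s (j + 1) 1 = s j 0 := fun j => hframe fun h0 => by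
    have h := (hb' j).eq_of_mem_in (hb j).zero_mem_out
    rw [real_inner_comm, horth', h0, zero_smul, zero_smul, add_zero] at h
    exact (b j).orthonormal.ne_zero 0 h
  have heig : ∀ {j i} {ν : ℝ}, linearization f (X.node j) (b j i) = ν • b j i →
      linearization f (X.node j) (w (s j i)) = ν • w (s j i) := by
    intro j i ν h
    rcases eq_or_eq_neg_symm (hs j i) with h' | h'
    · rw [h', h]
    · rw [h', map_neg, h, smul_neg]
  refine ⟨fun j => s j 0, fun j => ?_, fun j x hx i hi hi' => ?_, fun j => ?_, fun j => ?_,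
    fun j => ?_, fun j => ?_, fun j γ hγ hγj i => ?_⟩
  · obtain ⟨r, hr0, hr⟩ := hs' j 0
    exact ⟨‖X.node j‖ * r, mul_ne_zero (hnn j) hr0, by
      conv_lhs => rw [(hb j).node_eq, hr, smul_smul]⟩
  · have hi2 : i ≠ s j 2 := hexp j ▸ hi'
    obtain ⟨r, -, hr⟩ := hs' j 0
    obtain ⟨r', -, hr'⟩ := hs' j 2
    rw [(hb j).eq_of_mem_out hx, inner_add_right, inner_smul_right, inner_smul_right, hr, hr',
      inner_smul_right, inner_smul_right, w.inner_of_ne hi, w.inner_of_ne hi2]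
    simp
  · rw [← hexp]
    exact (hinj j).ne (by decide)
  · rw [← hexp, ← hcon]
    exact (hinj _).ne (by decide)
  · obtain ⟨μ, hμ, -, hpos⟩ := (hb j).eigen
    refine ⟨μ 2, hpos, ?_⟩
    rw [← hexp]
    exact heig (hμ 2)
  · obtain ⟨μ, hμ, hneg, -⟩ := (hb (j + 1)).eigen
    refine ⟨μ 1, hneg, ?_⟩
    rw [← hcon]
    exact heig (hμ 1)
  · obtain ⟨k, rfl⟩ := hsurj j i
    have hk := (hb j).sign γ hγ hγj k
    rcases hs j k with h | h
    · rwa [h] at hk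
    · rw [h, map_neg, neg_inj, neg_inj] at hk
      exact hk

end HeteroclinicCycle

namespace IsAxisMap

variable {f : R4 → R4} {Γ : Subgroup O4} {X : HeteroclinicCycle f Γ}
  {w : OrthonormalBasis (Fin 4) ℝ R4} {a : ZMod X.len → Fin 4}

theorem isTypeB_iff (ha : IsAxisMap X w a) (hw : IsRootFrame Γ w) :
    X.IsTypeB ↔ ∃ d, ∀ j, a j ≠ d := by
  constructor
  · intro hB
    obtain ⟨δ, hδ, hδX⟩ := HeteroclinicCycle.isTypeB_iff.1 hB
    obtain ⟨d, hd⟩ := hw.eq_of_isUnitRoot δ hδ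
    refine ⟨d, fun j hj => ?_⟩
    obtain ⟨ρ, hρ, hn⟩ := ha.node_eq j
    have h := hδX _ (X.node_mem_carrier j)
    rw [hn, hj, inner_smul_right] at h
    rcases hd with rfl | rfl
    · rw [w.inner_self_one, mul_one] at h
      exact hρ h
    · rw [inner_neg_left, w.inner_self_one] at h
      exact hρ (by linarith)
  · rintro ⟨d, hd⟩
    exact HeteroclinicCycle.isTypeB_of_forall_P (hw.isUnitRoot d) fun j x hx =>
      ha.inner_P j x hx d (hd j).symm (hd (j + 1)).symm

/-- Symmetric axes carry symmetric nodes. -/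
theorem exists_map_node (ha : IsAxisMap X w a) (hw : IsRootFrame Γ w) (hX : X.IsSimple)
    {i j : ZMod X.len} {γ : O4} (hγ : γ ∈ Γ)
    (h : γ (w (a i)) = w (a j) ∨ γ (w (a i)) = -w (a j)) :
    γ (X.node i) = X.node j ∨ γ (X.node i) = -X.node j := by
  obtain ⟨ρ, hρ, hn⟩ := ha.node_eq i
  obtain ⟨ρ', hρ', hn'⟩ := ha.node_eq j
  obtain ⟨c, hc0, hc⟩ : ∃ c : ℝ, c ≠ 0 ∧ γ (X.node i) = c • X.node j := by
    rcases h with h | h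
    · refine ⟨ρ / ρ', div_ne_zero hρ hρ', ?_⟩
      rw [hn, hn', map_smul, h, smul_smul, div_mul_cancel₀ _ hρ']
    · refine ⟨-(ρ / ρ'), neg_ne_zero.2 (div_ne_zero hρ hρ'), ?_⟩
      rw [hn, hn', map_smul, h, smul_smul, neg_mul, div_mul_cancel₀ _ hρ', smul_neg, neg_smul]
  -- The image lies on the line of the other node; on the wrong half-line, -Id corrects the sign.
  rcases lt_or_gt_of_ne hc0 with hlt | hgt
  · have h' := hX.eq_of_smul_node (i := i) (j := j) (c := -c) (Γ.mul_mem hw.neg_mem hγ)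
      (by linarith) (by
        rw [LinearIsometryEquiv.coe_mul, Function.comp_apply, hc, neg_smul]
        rfl)
    rw [LinearIsometryEquiv.coe_mul, Function.comp_apply] at h'
    exact Or.inr (neg_eq_iff_eq_neg.1 h')
  · exact Or.inl (hX.eq_of_smul_node hγ hgt hc)

theorem groupOrbit_node_eq_iff (ha : IsAxisMap X w a) (hw : IsRootFrame Γ w) (hX : X.IsSimple)
    {i j : ZMod X.len} : groupOrbit Γ (X.node i) = groupOrbit Γ (X.node j) ↔
      AxesRelated Γ w (a i) (a j) := by
  rw [groupOrbit_eq_iff]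
  constructor
  · rintro ⟨γ, hγ, h⟩
    obtain ⟨τ, -, hτ⟩ := hw.exists_axis_map hγ
    obtain ⟨ρ, hρ, hn⟩ := ha.node_eq i
    obtain ⟨ρ', hρ', hn'⟩ := ha.node_eq j
    have hτi : τ (a i) = a j := by
      rw [hn, hn', map_smul] at h
      by_contra hne
      have h0 : ⟪w (a j), ρ • γ (w (a i))⟫_ℝ = 0 := by
        rcases hτ (a i) with h' | h' <;>
          simp [h', inner_smul_right, w.inner_of_ne (Ne.symm hne)]
      rw [h, inner_smul_right, w.inner_self_one, mul_one] at h0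
      exact hρ' h0
    exact ⟨γ, hγ, hτi ▸ hτ (a i)⟩
  · rintro ⟨γ, hγ, h⟩
    rcases ha.exists_map_node hw hX hγ h with h | h
    · exact ⟨γ, hγ, h⟩
    · refine ⟨LinearIsometryEquiv.neg ℝ * γ, Γ.mul_mem hw.neg_mem hγ, ?_⟩
      rw [LinearIsometryEquiv.coe_mul, Function.comp_apply, h]
      exact neg_neg _

theorem numEquilibria_eq (ha : IsAxisMap X w a) (hw : IsRootFrame Γ w) (hX : X.IsSimple) :
    X.numEquilibria = ((fun i => groupOrbit Γ (w i)) '' Set.range a).ncard := by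
  rw [← Set.range_comp]
  exact ncard_range_congr fun i j => by
    rw [ha.groupOrbit_node_eq_iff hw hX, hw.axesRelated_iff]
    rfl

/-- A symmetry that preserves the axis of a node preserves all axes. -/
theorem map_eq_or_eq_neg (ha : IsAxisMap X w a) (hw : IsRootFrame Γ w) {j : ZMod X.len} {γ : O4}
    (hγ : γ ∈ Γ) (h : γ (w (a j)) = w (a j) ∨ γ (w (a j)) = -w (a j)) (i : Fin 4) :
    γ (w i) = w i ∨ γ (w i) = -w i := by
  obtain ⟨ρ, -, hn⟩ := ha.node_eq j
  rcases h with h | h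
  · exact ha.sign j γ hγ (by rw [hn, map_smul, h]) i
  · have := ha.sign j (LinearIsometryEquiv.neg ℝ * γ) (Γ.mul_mem hw.neg_mem hγ) (by
      rw [LinearIsometryEquiv.coe_mul, Function.comp_apply, hn, map_smul, h, smul_neg]
      exact neg_neg _) i
    rw [LinearIsometryEquiv.coe_mul, Function.comp_apply] at this
    rcases this with h | h
    · exact Or.inr (neg_eq_iff_eq_neg.1 h)
    · exact Or.inl (neg_injective h)

/-- No symmetry interchanges the axes of two consecutive nodes. -/
theorem not_swap (ha : IsAxisMap X w a) (hw : IsRootFrame Γ w) (hX : X.IsSimple)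
    (hf : ContDiff ℝ 1 f) (hΓ : IsEquivariant f Γ) {j : ZMod X.len} {γ : O4} (hγ : γ ∈ Γ)
    (h : γ (w (a j)) = w (a (j + 1)) ∨ γ (w (a j)) = -w (a (j + 1)))
    (h' : γ (w (a (j + 1))) = w (a j) ∨ γ (w (a (j + 1))) = -w (a j)) : False := by
  obtain ⟨ν, hν, he⟩ := ha.expanding j
  obtain ⟨ν', hν', he'⟩ := ha.contracting j
  have key : ∀ g ∈ Γ, g (X.node j) = X.node (j + 1) →
      (g (w (a (j + 1))) = w (a j) ∨ g (w (a (j + 1))) = -w (a j)) → False := by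
    intro g hg hgn hgw
    have hl := linearization_map hf hΓ hg (X.node j) (w (a (j + 1)))
    rw [he, map_smul, hgn] at hl
    have hl' : linearization f (X.node (j + 1)) (w (a j)) = ν • w (a j) := by
      rcases hgw with h | h
      · rwa [h] at hl
      · rw [h, map_neg, smul_neg, neg_inj] at hl
        exact hl
    -- The symmetry would carry the expanding direction at one node to the contracting direction at
    -- the next, with the same eigenvalue.
    rw [he'] at hl'
    have := smul_left_injective ℝ (w.orthonormal.ne_zero (a j)) hl'
    linarith
  rcases ha.exists_map_node hw hX hγ h with hn | hn
  · exact key γ hγ hn h'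
  · refine key (LinearIsometryEquiv.neg ℝ * γ) (Γ.mul_mem hw.neg_mem hγ) ?_ ?_
    · rw [LinearIsometryEquiv.coe_mul, Function.comp_apply, hn]
      exact neg_neg _
    · rw [LinearIsometryEquiv.coe_mul, Function.comp_apply]
      rcases h' with h' | h' <;> rw [h']
      · exact Or.inr rfl
      · exact Or.inl (neg_neg _)

/-! ### Cycles that avoid one axis -/

section MissingAxis

variable {d : Fin 4}

/-- Three consecutive axes are distinct and only three are available, so they recur with period
three. -/
theorem succ_three (ha : IsAxisMap X w a) (hd : ∀ j, a j ≠ d) (j : ZMod X.len) :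
    a (j + 1 + 1 + 1) = a j := by
  have h1 := ha.ne_succ j
  have h2 := ha.ne_succ (j + 1)
  have h3 := ha.ne_succ (j + 1 + 1)
  have h4 := ha.ne_succ_succ j
  have h5 := ha.ne_succ_succ (j + 1)
  have := hd j
  have := hd (j + 1)
  have := hd (j + 1 + 1)
  have := hd (j + 1 + 1 + 1)
  omega

theorem eq_of_missing (ha : IsAxisMap X w a) (hd : ∀ j, a j ≠ d) (j : ZMod X.len) (i : Fin 4) :
    i = a j ∨ i = a (j + 1) ∨ i = a (j + 1 + 1) ∨ i = d := by
  have h1 := ha.ne_succ j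
  have h2 := ha.ne_succ (j + 1)
  have h4 := ha.ne_succ_succ j
  have := hd j
  have := hd (j + 1)
  have := hd (j + 1 + 1)
  omega

/-- Not all axes of nodes are related. -/
theorem not_axesRelated_both (ha : IsAxisMap X w a) (hw : IsRootFrame Γ w) (hX : X.IsSimple)
    (hd : ∀ j, a j ≠ d) {j : ZMod X.len} (h1 : AxesRelated Γ w (a j) (a (j + 1)))
    (h2 : AxesRelated Γ w (a (j + 1)) (a (j + 1 + 1))) : False := by
  have h0 : AxesRelated Γ w (a j) (a j) := ⟨1, Γ.one_mem, Or.inl rfl⟩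
  have hall : ∀ i, AxesRelated Γ w (a j) (a i) := by
    intro i
    rcases ha.eq_of_missing hd j (a i) with h | h | h | h
    · rw [h]; exact h0
    · rw [h]; exact h1
    · rw [h]; exact h1.trans h2
    · exact absurd h (hd i)
  exact X.not_homoclinic fun i => mem_groupOrbit_of_eq
    ((ha.groupOrbit_node_eq_iff hw hX).2 ((hall i).symm.trans (hall 0)))

/-- Let x, y, z be consecutive axes and suppose a symmetry sends x to y. If y goes to x, two
consecutive nodes are interchanged; if y goes to z, all nodes are symmetric. If y goes to the
missing axis `d`, then `d` goes to z, making all nodes symmetric, or to x; in the latter case z is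
preserved, and hence so is every axis. -/
theorem not_axesRelated_succ (ha : IsAxisMap X w a) (hw : IsRootFrame Γ w) (hX : X.IsSimple)
    (hf : ContDiff ℝ 1 f) (hΓ : IsEquivariant f Γ) (hd : ∀ j, a j ≠ d) (j : ZMod X.len) :
    ¬ AxesRelated Γ w (a j) (a (j + 1)) := by
  intro h1
  obtain ⟨γ, hγ, h⟩ := id h1
  obtain ⟨τ, hτinj, hτ⟩ := hw.exists_axis_map hγ
  have hrel : ∀ i, AxesRelated Γ w i (τ i) := fun i => ⟨γ, hγ, hτ i⟩
  have hx : τ (a j) = a (j + 1) := w.eq_of_eq_or_eq_neg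
    (eq_or_eq_neg_trans (eq_or_eq_neg_symm (hτ (a j))) h)
  have hnot := fun h2 => ha.not_axesRelated_both hw hX hd h1 h2
  have hne := ha.ne_succ j
  rcases ha.eq_of_missing hd j (τ (a (j + 1))) with hy | hy | hy | hy
  · exact ha.not_swap hw hX hf hΓ hγ h (hy ▸ hτ (a (j + 1)))
  · exact hne (hτinj (hx.trans hy.symm))
  · exact hnot (hy ▸ hrel (a (j + 1)))
  · have hyd : AxesRelated Γ w (a (j + 1)) d := hy ▸ hrel (a (j + 1))
    rcases ha.eq_of_missing hd j (τ d) with ht | ht | ht | ht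
    · have hz : τ (a (j + 1 + 1)) = a (j + 1 + 1) := by
        rcases ha.eq_of_missing hd j (τ (a (j + 1 + 1))) with hz | hz | hz | hz
        · exact absurd (hτinj (hz.trans ht.symm)) (hd _)
        · exact absurd (hτinj (hx.trans hz.symm)) (ha.ne_succ_succ j)
        · exact hz
        · exact absurd (hτinj (hy.trans hz.symm)) (ha.ne_succ (j + 1))
      have hfix := ha.map_eq_or_eq_neg hw hγ (j := j + 1 + 1)
        (by have := hτ (a (j + 1 + 1)); rwa [hz] at this) (a j)
      exact hne (w.eq_of_eq_or_eq_neg (eq_or_eq_neg_trans (eq_or_eq_neg_symm hfix) h))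
    · exact hd j (hτinj (hx.trans ht.symm))
    · exact hnot (hyd.trans (ht ▸ hrel d))
    · exact hd (j + 1) (hτinj (hy.trans ht.symm))

theorem not_axesRelated_missing (ha : IsAxisMap X w a) (hw : IsRootFrame Γ w) (hX : X.IsSimple)
    (hf : ContDiff ℝ 1 f) (hΓ : IsEquivariant f Γ) (hd : ∀ j, a j ≠ d) (j : ZMod X.len) :
    ¬ AxesRelated Γ w (a j) d := by
  rintro ⟨γ, hγ, h⟩
  obtain ⟨τ, hτinj, hτ⟩ := hw.exists_axis_map hγ
  have hrel : ∀ i, AxesRelated Γ w i (τ i) := fun i => ⟨γ, hγ, hτ i⟩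
  have hx : τ (a j) = d := w.eq_of_eq_or_eq_neg
    (eq_or_eq_neg_trans (eq_or_eq_neg_symm (hτ (a j))) h)
  have hsucc := ha.not_axesRelated_succ hw hX hf hΓ hd
  rcases ha.eq_of_missing hd j (τ (a (j + 1))) with hy | hy | hy | hy
  · exact hsucc j (hy ▸ (hrel (a (j + 1))).symm)
  · have hfix := ha.map_eq_or_eq_neg hw hγ (j := j + 1)
      (by have := hτ (a (j + 1)); rwa [hy] at this) (a j)
    exact hd j (w.eq_of_eq_or_eq_neg (eq_or_eq_neg_trans (eq_or_eq_neg_symm hfix) h))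
  · exact hsucc (j + 1) (hy ▸ hrel (a (j + 1)))
  · exact ha.ne_succ j (hτinj (hx.trans hy.symm))

/-- If some axis carries no node then no two axes are related by symmetry. -/
theorem groupOrbit_injective (ha : IsAxisMap X w a) (hw : IsRootFrame Γ w) (hX : X.IsSimple)
    (hf : ContDiff ℝ 1 f) (hΓ : IsEquivariant f Γ) (hd : ∀ j, a j ≠ d) :
    Function.Injective fun i => groupOrbit Γ (w i) := by
  have hsucc := ha.not_axesRelated_succ hw hX hf hΓ hd
  have hmiss := ha.not_axesRelated_missing hw hX hf hΓ hd
  have key : ∀ j i, AxesRelated Γ w (a j) i → a j = i := by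
    intro j i hr
    rcases ha.eq_of_missing hd j i with h | h | h | h
    · exact h.symm
    · exact absurd (h ▸ hr) (hsucc j)
    · have := hsucc (j + 1 + 1)
      rw [ha.succ_three hd] at this
      exact absurd (h ▸ hr.symm) this
    · exact absurd (h ▸ hr) (hmiss j)
  intro i k hik
  have hr : AxesRelated Γ w i k := hw.axesRelated_iff.2 hik
  rcases ha.eq_of_missing hd 0 i with h | h | h | h
  · exact h.trans (key _ k (h ▸ hr))
  · exact h.trans (key _ k (h ▸ hr))
  · exact h.trans (key _ k (h ▸ hr))
  · rcases ha.eq_of_missing hd 0 k with h' | h' | h' | h'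
    · exact ((h'.trans (key _ i (h' ▸ hr.symm)))).symm
    · exact ((h'.trans (key _ i (h' ▸ hr.symm)))).symm
    · exact ((h'.trans (key _ i (h' ▸ hr.symm)))).symm
    · exact h.trans h'.symm

theorem numEquilibria_of_missing (ha : IsAxisMap X w a) (hw : IsRootFrame Γ w)
    (hX : X.IsSimple) (hf : ContDiff ℝ 1 f) (hΓ : IsEquivariant f Γ) (hd : ∀ j, a j ≠ d) :
    X.numEquilibria = 3 := by
  have hrange : Set.range a = {d}ᶜ := by
    ext i
    constructor
    · rintro ⟨j, rfl⟩
      exact hd j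
    · intro hi
      rcases ha.eq_of_missing hd 0 i with h | h | h | h
      · exact ⟨_, h.symm⟩
      · exact ⟨_, h.symm⟩
      · exact ⟨_, h.symm⟩
      · exact absurd h hi
  rw [ha.numEquilibria_eq hw hX,
    Set.ncard_image_of_injective _ (ha.groupOrbit_injective hw hX hf hΓ hd), hrange]
  have := Set.ncard_add_ncard_compl ({d} : Set (Fin 4))
  rw [Set.ncard_singleton, Nat.card_eq_fintype_card, Fintype.card_fin] at this
  omega

end MissingAxis

theorem numEquilibria_of_surjective (ha : IsAxisMap X w a) (hw : IsRootFrame Γ w)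
    (hX : X.IsSimple) (hs : Function.Surjective a) :
    X.numEquilibria = (Set.range fun i => groupOrbit Γ (w i)).ncard := by
  rw [ha.numEquilibria_eq hw hX, hs.range_eq, Set.image_univ]

theorem surjective_of_not_isTypeB (ha : IsAxisMap X w a) (hw : IsRootFrame Γ w)
    (hB : ¬ X.IsTypeB) : Function.Surjective a := by
  rw [ha.isTypeB_iff hw] at hB
  push Not at hB
  exact hB

end IsAxisMap

/-! ### Comparison of two cycles -/

namespace HeteroclinicCycle

variable {f : R4 → R4} {Γ : Subgroup O4} {X Y : HeteroclinicCycle f Γ}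

theorem IsSimple.isAntipodalAt_of_neg_notMem (hX : X.IsSimple) (hf : ContDiff ℝ 1 f)
    (hfin : Finite Γ) (hΓ : IsEquivariant f Γ) (hA : ¬ X.IsTypeA)
    (hneg : (LinearIsometryEquiv.neg ℝ : O4) ∉ Γ) (j : ZMod X.len) : X.IsAntipodalAt j := by
  rcases hX.forall_isAntipodalAt_or hf hfin hΓ hA with h | h
  · exact h j
  · obtain ⟨w, hw⟩ := hX.exists_isRootFrame hf hfin hΓ hA h
    exact absurd hw.neg_mem hneg

theorem IsSimple.not_isAntipodalAt_of_neg_mem (hX : X.IsSimple) (hf : ContDiff ℝ 1 f)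
    (hfin : Finite Γ) (hΓ : IsEquivariant f Γ) (hA : ¬ X.IsTypeA)
    (hneg : (LinearIsometryEquiv.neg ℝ : O4) ∈ Γ) (j : ZMod X.len) : ¬ X.IsAntipodalAt j := by
  rcases hX.forall_isAntipodalAt_or hf hfin hΓ hA with h | h
  · exact absurd hneg (hX.neg_notMem_of_isAntipodalAt h)
  · exact h j

/-- Two simple cycles for the same field, neither of type A, are of the same type with the same
number of equilibria, or one is of type `B₃⁻` and the other of type `C₄⁻`. -/
theorem IsSimple.type_alternatives (hX : X.IsSimple) (hY : Y.IsSimple) (hf : ContDiff ℝ 1 f)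
    (hfin : Finite Γ) (hΓ : IsEquivariant f Γ) (hXA : ¬ X.IsTypeA) (hYA : ¬ Y.IsTypeA) :
    ((X.IsTypeB ↔ Y.IsTypeB) ∧ Y.numEquilibria = X.numEquilibria) ∨
    (X.IsTypeB3Minus ∧ Y.IsTypeC4Minus) ∨ (X.IsTypeC4Minus ∧ Y.IsTypeB3Minus) := by
  by_cases hneg : (LinearIsometryEquiv.neg ℝ : O4) ∈ Γ
  · have hXn := hX.not_isAntipodalAt_of_neg_mem hf hfin hΓ hXA hneg
    have hYn := hY.not_isAntipodalAt_of_neg_mem hf hfin hΓ hYA hneg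
    obtain ⟨w, hw⟩ := hX.exists_isRootFrame hf hfin hΓ hXA hXn
    obtain ⟨a, ha⟩ := hX.exists_isAxisMap hf hfin hΓ hXA hXn hw
    obtain ⟨a', ha'⟩ := hY.exists_isAxisMap hf hfin hΓ hYA hYn hw
    have hfour : (Function.Injective fun i => groupOrbit Γ (w i)) →
        (Set.range fun i => groupOrbit Γ (w i)).ncard = 4 := fun hinj => by
      rw [Set.ncard_range_of_injective hinj, Nat.card_eq_fintype_card, Fintype.card_fin]
    by_cases hXB : X.IsTypeB <;> by_cases hYB : Y.IsTypeB
    · obtain ⟨d, hd⟩ := (ha.isTypeB_iff hw).1 hXB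
      obtain ⟨d', hd'⟩ := (ha'.isTypeB_iff hw).1 hYB
      exact Or.inl ⟨iff_of_true hXB hYB, by
        rw [ha.numEquilibria_of_missing hw hX hf hΓ hd,
          ha'.numEquilibria_of_missing hw hY hf hΓ hd']⟩
    · obtain ⟨d, hd⟩ := (ha.isTypeB_iff hw).1 hXB
      refine Or.inr (Or.inl ⟨⟨hXB, ha.numEquilibria_of_missing hw hX hf hΓ hd, hneg⟩,
        ⟨hYA, hYB⟩, ?_, hneg⟩)
      rw [ha'.numEquilibria_of_surjective hw hY (ha'.surjective_of_not_isTypeB hw hYB)]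
      -- The axis missed by `X` forces the four axes into different orbits, which is a statement
      -- about Γ alone and so counts the equilibria of `Y`.
      exact hfour (ha.groupOrbit_injective hw hX hf hΓ hd)
    · obtain ⟨d, hd⟩ := (ha'.isTypeB_iff hw).1 hYB
      refine Or.inr (Or.inr ⟨⟨⟨hXA, hXB⟩, ?_, hneg⟩,
        hYB, ha'.numEquilibria_of_missing hw hY hf hΓ hd, hneg⟩)
      rw [ha.numEquilibria_of_surjective hw hX (ha.surjective_of_not_isTypeB hw hXB)]
      exact hfour (ha'.groupOrbit_injective hw hY hf hΓ hd)
    · exact Or.inl ⟨iff_of_false hXB hYB, by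
        rw [ha.numEquilibria_of_surjective hw hX (ha.surjective_of_not_isTypeB hw hXB),
          ha'.numEquilibria_of_surjective hw hY (ha'.surjective_of_not_isTypeB hw hYB)]⟩
  · have hXn := hX.isAntipodalAt_of_neg_notMem hf hfin hΓ hXA hneg
    have hYn := hY.isAntipodalAt_of_neg_notMem hf hfin hΓ hYA hneg
    refine Or.inl ⟨iff_of_true (hX.isTypeB_of_isAntipodalAt hf hΓ hXA hXn)
      (hY.isTypeB_of_isAntipodalAt hf hΓ hYA hYn), ?_⟩
    rw [hX.numEquilibria_of_isAntipodalAt hXn, hY.numEquilibria_of_isAntipodalAt hYn]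

end HeteroclinicCycle

theorem mainTheorem3 (f : R4 → R4) (hf : ContDiff ℝ 1 f)
    (Γ : Subgroup O4) (hΓfin : Finite Γ) (hΓ : IsEquivariant f Γ)
    {ι : Type*} (X : ι → HeteroclinicCycle f Γ) (hX : IsSimpleNetwork X) (k l : ι) :
    ((X k).IsTypeA → (X l).IsTypeA ∧ ¬ (X l).IsTypeB) ∧
    ((X k).IsTypeB →
      ((X l).IsTypeB ∧ (X l).numEquilibria = (X k).numEquilibria) ∨
      ((X k).IsTypeB3Minus ∧ (X l).IsTypeC4Minus)) ∧
    ((X k).IsTypeC →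
      ((X l).IsTypeC ∧ (X l).numEquilibria = (X k).numEquilibria) ∨
      ((X k).IsTypeC4Minus ∧ (X l).IsTypeB3Minus)) := by
  have hk := hX.simple k
  have hl := hX.simple l
  have hAl : ¬ (X k).IsTypeA → ¬ (X l).IsTypeA := fun h h' =>
    h (hX.isTypeA_of_isTypeA hf hΓ h' k)
  have halt := fun h => hk.type_alternatives hl hf hΓfin hΓ h (hAl h)
  refine ⟨fun hA => ?_, fun hB => ?_, fun hC => ?_⟩
  · have := hX.isTypeA_of_isTypeA hf hΓ hA l
    exact ⟨this, hl.not_isTypeB_of_isTypeA hf hΓ this⟩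
  · rcases halt fun hA => hk.not_isTypeB_of_isTypeA hf hΓ hA hB with h | h | h
    · exact Or.inl ⟨h.1.1 hB, h.2⟩
    · exact Or.inr h
    · exact absurd hB h.1.1.2
  · rcases halt hC.1 with h | h | h
    · exact Or.inl ⟨⟨hAl hC.1, fun hB => hC.2 (h.1.2 hB)⟩, h.2⟩
    · exact absurd h.1.1 hC.2
    · exact Or.inr h
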